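/- For every constant $q\ge 1$, the $q$-th power version of the min-bisection problem over doubling metric spaces admits a PTAS. In detail: for a finite space $T$ with a distance $d$ that is symmetric, satisfies the triangle inequality and has $d(u,u)=0$ (distinct points at distance $0$ are allowed), with $|T|=k$ even, let $\mathrm{bp}^q(T)$ be the minimum of $\sum_{\ell\in L,\, r\in T\setminus L} d(\ell,r)^q$ over all $L\subseteq T$ with $|L|=k/2$. For every real $q\ge 1$ there is one algorithm that receives $\varepsilon>0$, the number $k$ and the $k\times k$ table of distances, and such that for every $\varepsilon>0$ and every $D\ge 0$ there is a polynomial $p$ with the following property. For every even $k\ge 4$ and every $k$-point space $(T,d)$ of doubling dimension at most $D$ (every closed ball of radius $r>0$ is covered by at most $2^D$ closed balls of radius $r/2$ with centers in $T$), the algorithm halts after at most $p(k)$ steps and outputs a set $L\subseteq T$ with $|L|=k/2$ and \[ \sum_{\ell\in L,\ r\in T\setminus L} d(\ell,r)^q \;\le\; (1+\varepsilon)\,\mathrm{bp}^q(T). \] Steps are counted on a real RAM: at unit cost it performs $+,-,\times,\div$, comparison and $x\mapsto |x|^q$ on real numbers, addition, truncated subtraction and comparison on nonnegative integers, conversion of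 integers to reals, and memory access at computed integer addresses; $q$ and $\varepsilon$ are available as real constants. -/

import Mathlib

/-! ## The min-bisection problem -/

/-- The doubling dimension of `T` is at most `D`: every closed ball of positive radius can be covered
by at most `2 ^ D` closed balls of half its radius, with centers in `T`. -/
def DoublingDimLE (T : Type*) [PseudoMetricSpace T] (D : ℝ) : Prop :=
  ∀ (u : T) (r : ℝ), 0 < r → ∃ C : Finset T, (C.card : ℝ) ≤ (2 : ℝ) ^ D ∧
    Metric.closedBall u r ⊆ ⋃ v ∈ C, Metric.closedBall v (r / 2)

/-- The objective value of the bipartition `(L, T \ L)`: the sum of `d(l, r) ^ q` over all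
cross pairs. -/
noncomputable def cutCost (q : ℝ) {T : Type*} [PseudoMetricSpace T] [Fintype T] [DecidableEq T]
    (L : Finset T) : ℝ :=
  ∑ l ∈ L, ∑ r ∈ Lᶜ, dist l r ^ q

/-- The optimal value: the minimum of `cutCost` over all `L` with `⌊|T| / 2⌋` elements. -/
noncomputable def minBisection (q : ℝ) (T : Type*) [PseudoMetricSpace T] [Fintype T]
    [DecidableEq T] : ℝ :=
  (Finset.powersetCard (Fintype.card T / 2) (Finset.univ : Finset T)).inf'
    (Finset.powersetCard_nonempty.2 (Nat.div_le_self _ _)) (cutCost q)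

/-! ## The machine model

A real RAM, programmed in a structured language with a cost semantics. A program uses integer arrays
and real arrays (each program mentions finitely many of them, by a fixed number), whose cells are
addressed by computed integers. Integers allow addition, truncated subtraction and comparison only
(no multiplication, division or bit operations), so that unit cost is realistic. Reals allow the four
field operations, comparison, and `x ↦ |x| ^ q` for the fixed exponent `q` of the problem; there is
no rounding of reals to integers and no real constant other than those of the problem. -/

namespace RealRAM

/-- The read-only data of a run: the number of points, the distance of points `i` and `j`, the
exponent `q` and the error parameter `ε`. -/
structure Input where
  size : ℕ
  dist : ℕ → ℕ → ℝ
  q : ℝ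
  eps : ℝ

/-- Memory: cell `i` of integer array `x` holds `nat x i`, cell `i` of real array `x` holds
`real x i`. -/
structure Memory where
  nat : ℕ → ℕ → ℕ
  real : ℕ → ℕ → ℝ

/-- The blank memory. -/
noncomputable def Memory.init : Memory := ⟨fun _ _ => 0, fun _ _ => 0⟩

/-- Write `v` to cell `i` of integer array `x`. -/
noncomputable def Memory.setNat (m : Memory) (x i v : ℕ) : Memory :=
  { m with nat := Function.update m.nat x (Function.update (m.nat x) i v) }

/-- Write `v` to cell `i` of real array `x`. -/
noncomputable def Memory.setReal (m : Memory) (x i : ℕ) (v : ℝ) : Memory :=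
  { m with real := Function.update m.real x (Function.update (m.real x) i v) }

/-- Integer expressions. -/
inductive NExp where
  | lit (n : ℕ)
  | size
  | get (x : ℕ) (i : NExp)
  | add (a b : NExp)
  | sub (a b : NExp)

/-- Real expressions. -/
inductive RExp where
  | ofNat (a : NExp)
  | q
  | eps
  | dist (i j : NExp)
  | get (x : ℕ) (i : NExp)
  | add (a b : RExp)
  | sub (a b : RExp)
  | mul (a b : RExp)
  | div (a b : RExp)
  | pow (a : RExp)

/-- Tests. -/
inductive Test where
  | natLe (a b : NExp)
  | realLe (a b : RExp)
  | not (b : Test)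
  | and (b c : Test)

/-- Programs. -/
inductive Prog where
  | skip
  | setNat (x : ℕ) (i e : NExp)
  | setReal (x : ℕ) (i : NExp) (e : RExp)
  | seq (c d : Prog)
  | branch (b : Test) (c d : Prog)
  | loop (b : Test) (c : Prog)

/-- The value of an integer expression. -/
def NExp.eval (I : Input) (m : Memory) : NExp → ℕ
  | lit n => n
  | size => I.size
  | get x i => m.nat x (i.eval I m)
  | add a b => a.eval I m + b.eval I m
  | sub a b => a.eval I m - b.eval I m

/-- The cost of an integer expression: its number of operations. -/
def NExp.cost : NExp → ℕ
  | lit _ => 1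
  | size => 1
  | get _ i => i.cost + 1
  | add a b => a.cost + b.cost + 1
  | sub a b => a.cost + b.cost + 1

/-- The value of a real expression. -/
noncomputable def RExp.eval (I : Input) (m : Memory) : RExp → ℝ
  | ofNat a => (a.eval I m : ℝ)
  | q => I.q
  | eps => I.eps
  | dist i j => I.dist (i.eval I m) (j.eval I m)
  | get x i => m.real x (i.eval I m)
  | add a b => a.eval I m + b.eval I m
  | sub a b => a.eval I m - b.eval I m
  | mul a b => a.eval I m * b.eval I m
  | div a b => a.eval I m / b.eval I m
  | pow a => |a.eval I m| ^ I.q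

/-- The cost of a real expression: its number of operations. -/
def RExp.cost : RExp → ℕ
  | ofNat a => a.cost + 1
  | q => 1
  | eps => 1
  | dist i j => i.cost + j.cost + 1
  | get _ i => i.cost + 1
  | add a b => a.cost + b.cost + 1
  | sub a b => a.cost + b.cost + 1
  | mul a b => a.cost + b.cost + 1
  | div a b => a.cost + b.cost + 1
  | pow a => a.cost + 1

/-- The truth of a test. -/
def Test.Holds (I : Input) (m : Memory) : Test → Prop
  | natLe a b => a.eval I m ≤ b.eval I m
  | realLe a b => a.eval I m ≤ b.eval I m
  | not b => ¬ b.Holds I m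
  | and b c => b.Holds I m ∧ c.Holds I m

/-- The cost of a test: its number of operations. -/
def Test.cost : Test → ℕ
  | natLe a b => a.cost + b.cost + 1
  | realLe a b => a.cost + b.cost + 1
  | not b => b.cost + 1
  | and b c => b.cost + c.cost + 1

/-- `Exec I c m m' t`: on input `I`, the program `c` started in memory `m` halts in memory `m'` after
exactly `t` steps. -/
inductive Exec (I : Input) : Prog → Memory → Memory → ℕ → Prop where
  | skip (m : Memory) : Exec I .skip m m 1
  | setNat (m : Memory) (x : ℕ) (i e : NExp) :
      Exec I (.setNat x i e) m (m.setNat x (i.eval I m) (e.eval I m)) (i.cost + e.cost + 1)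
  | setReal (m : Memory) (x : ℕ) (i : NExp) (e : RExp) :
      Exec I (.setReal x i e) m (m.setReal x (i.eval I m) (e.eval I m)) (i.cost + e.cost + 1)
  | seq {c d : Prog} {m₁ m₂ m₃ : Memory} {s t : ℕ} :
      Exec I c m₁ m₂ s → Exec I d m₂ m₃ t → Exec I (.seq c d) m₁ m₃ (s + t)
  | branchTrue {b : Test} {c d : Prog} {m m' : Memory} {t : ℕ} :
      b.Holds I m → Exec I c m m' t → Exec I (.branch b c d) m m' (b.cost + t + 1)
  | branchFalse {b : Test} {c d : Prog} {m m' : Memory} {t : ℕ} :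
      ¬ b.Holds I m → Exec I d m m' t → Exec I (.branch b c d) m m' (b.cost + t + 1)
  | loopDone {b : Test} {c : Prog} {m : Memory} :
      ¬ b.Holds I m → Exec I (.loop b c) m m (b.cost + 1)
  | loopStep {b : Test} {c : Prog} {m₁ m₂ m₃ : Memory} {s t : ℕ} :
      b.Holds I m₁ → Exec I c m₁ m₂ s → Exec I (.loop b c) m₂ m₃ t →
      Exec I (.loop b c) m₁ m₃ (b.cost + s + t + 1)

/-- The machine is deterministic: final memory and number of steps are functions of the input. -/
theorem Exec.unique {I : Input} {c : Prog} {m m₁ m₂ : Memory} {t₁ t₂ : ℕ}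
    (h₁ : Exec I c m m₁ t₁) (h₂ : Exec I c m m₂ t₂) : m₁ = m₂ ∧ t₁ = t₂ := by
  induction h₁ generalizing m₂ t₂ with
  | skip => cases h₂; exact ⟨rfl, rfl⟩
  | setNat => cases h₂; exact ⟨rfl, rfl⟩
  | setReal => cases h₂; exact ⟨rfl, rfl⟩
  | seq _ _ ih ih' =>
    cases h₂ with
    | seq a b =>
      obtain ⟨rfl, rfl⟩ := ih a
      obtain ⟨rfl, rfl⟩ := ih' b
      exact ⟨rfl, rfl⟩
  | branchTrue hb _ ih =>
    cases h₂ with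
    | branchTrue _ a => obtain ⟨rfl, rfl⟩ := ih a; exact ⟨rfl, rfl⟩
    | branchFalse hb' _ => exact absurd hb hb'
  | branchFalse hb _ ih =>
    cases h₂ with
    | branchTrue hb' _ => exact absurd hb' hb
    | branchFalse _ a => obtain ⟨rfl, rfl⟩ := ih a; exact ⟨rfl, rfl⟩
  | loopDone hb =>
    cases h₂ with
    | loopDone _ => exact ⟨rfl, rfl⟩
    | loopStep hb' _ _ => exact absurd hb' hb
  | loopStep hb _ _ ih ih' =>
    cases h₂ with
    | loopDone hb' => exact absurd hb hb'
    | loopStep _ a b =>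
      obtain ⟨rfl, rfl⟩ := ih a
      obtain ⟨rfl, rfl⟩ := ih' b
      exact ⟨rfl, rfl⟩

/-- The input that presents the points of `T`, numbered by `e`, with exponent `q` and error
parameter `ε`. -/
noncomputable def Input.ofMetric {T : Type*} [PseudoMetricSpace T] {k : ℕ} (e : Fin k ≃ T)
    (q ε : ℝ) : Input where
  size := k
  dist i j := if h : i < k ∧ j < k then Dist.dist (e ⟨i, h.1⟩) (e ⟨j, h.2⟩) else 0
  q := q
  eps := ε

/-- The set of points that a final memory describes: point `i` belongs to it if and only if cell `i`
of integer array `0` holds `1`. -/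
def Memory.output {T : Type*} [Fintype T] [DecidableEq T] {k : ℕ} (e : Fin k ≃ T)
    (m : Memory) : Finset T :=
  Finset.univ.filter fun u => m.nat 0 (e.symm u) = 1

end RealRAM

/-! Write f = d^q, w(u) = ∑ f(u,v) over v, and S = ∑ w(u). Instead of the triangle inequality, f
satisfies f(x,z) ≤ (1+η) f(x,y) + B f(y,z), where η can be made small at the price of a large B. In
a balanced bipartition the cut carries a constant fraction of S (`sum_pointWeight_le_cutWeight`), so
errors that are small multiples of S are affordable.

Fix a large resolution X depending on q and ε. Call u far if k·w(u) > X·S, and near otherwise. There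
are at most k/X far points. Averaging the relaxed inequality shows that together they contribute
about half of their total weight to the cut, however they are distributed: the opposite side has k/2
points, and most of them see a far point u at f-distance about w(u)/k. The near points are grouped
around a greedy net at scale f ≤ S/(X k²), and moving them to their centers changes the cut little.
Hence, with the far points as one further cluster, the numbers of points taken from the clusters
determine the value of a balanced bipartition up to a factor 1+ε (`cutWeight_le_of_card_eq`,
`cutWeight_powDist_le`).

Two near points satisfy f ≤ 2·2^q·X·S/k², while two net points satisfy f > S/(X k²). The ratio
2·2^q·X² does not depend on k, so doubling bounds the size of the net (`DoublingDimLE.card_net_le`).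
With M clusters it suffices to try the (k+1)^M vectors of counts, each realised by the first points
of every cluster (`Clustering.exists_selection`). The doubling dimension enters only the bound on M,
hence only the running time; the program does not know it. -/

namespace RealRAM

/-! ### A calculus for total correctness with step bounds -/

/-- Started in memory `m`, the program `c` halts after at most `T` steps in a memory satisfying `Q`. -/
def Ends (I : Input) (c : Prog) (m : Memory) (T : ℕ) (Q : Memory → Prop) : Prop :=
  ∃ (m' : Memory) (t : ℕ), Exec I c m m' t ∧ t ≤ T ∧ Q m'

@[simp] theorem Memory.setNat_nat (m : Memory) (x i v y j : ℕ) :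
    (m.setNat x i v).nat y j = if y = x ∧ j = i then v else m.nat y j := by
  simp only [Memory.setNat, Function.update_apply]
  by_cases h : y = x
  · subst h; by_cases h' : j = i <;> simp [h']
  · simp [h]

@[simp] theorem Memory.setNat_real (m : Memory) (x i v : ℕ) : (m.setNat x i v).real = m.real := rfl

@[simp] theorem Memory.setReal_nat (m : Memory) (x i : ℕ) (v : ℝ) :
    (m.setReal x i v).nat = m.nat := rfl

@[simp] theorem Memory.setReal_real (m : Memory) (x i : ℕ) (v : ℝ) (y j : ℕ) :
    (m.setReal x i v).real y j = if y = x ∧ j = i then v else m.real y j := by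
  simp only [Memory.setReal, Function.update_apply]
  by_cases h : y = x
  · subst h; by_cases h' : j = i <;> simp [h']
  · simp [h]

/-- The memories `m` and `m'` differ at most in the integer arrays listed in `ns` and the real arrays
listed in `rs`. -/
def Frame (ns rs : List ℕ) (m m' : Memory) : Prop :=
  (∀ x, x ∉ ns → ∀ i, m'.nat x i = m.nat x i) ∧ (∀ x, x ∉ rs → ∀ i, m'.real x i = m.real x i)

theorem Frame.refl (ns rs : List ℕ) (m : Memory) : Frame ns rs m m :=
  ⟨fun _ _ _ => rfl, fun _ _ _ => rfl⟩

theorem Frame.setNat {ns rs : List ℕ} {m m' : Memory} (h : Frame ns rs m m') {x : ℕ}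
    (hx : x ∈ ns) (i v : ℕ) : Frame ns rs m (m'.setNat x i v) := by
  refine ⟨fun y hy j => ?_, h.2⟩
  have : y ≠ x := fun e => hy (e ▸ hx)
  simp [this, h.1 y hy j]

theorem Frame.setReal {ns rs : List ℕ} {m m' : Memory} (h : Frame ns rs m m') {x : ℕ}
    (hx : x ∈ rs) (i : ℕ) (v : ℝ) : Frame ns rs m (m'.setReal x i v) := by
  refine ⟨h.1, fun y hy j => ?_⟩
  have : y ≠ x := fun e => hy (e ▸ hx)
  simp [this, h.2 y hy j]

theorem Frame.trans {ns rs ns' rs' : List ℕ} {m₁ m₂ m₃ : Memory} (h : Frame ns rs m₁ m₂)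
    (h' : Frame ns' rs' m₂ m₃) (hn : ns' ⊆ ns) (hr : rs' ⊆ rs) : Frame ns rs m₁ m₃ :=
  ⟨fun x hx i => (h'.1 x (fun e => hx (hn e)) i).trans (h.1 x hx i),
    fun x hx i => (h'.2 x (fun e => hx (hr e)) i).trans (h.2 x hx i)⟩

namespace Ends

variable {I : Input} {c d : Prog} {m : Memory} {T T' : ℕ} {Q Q' : Memory → Prop}

theorem mono (h : Ends I c m T Q) (hT : T ≤ T') (hQ : ∀ m', Q m' → Q' m') : Ends I c m T' Q' := by
  obtain ⟨m', t, h, ht, hq⟩ := h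
  exact ⟨m', t, h, ht.trans hT, hQ _ hq⟩

theorem le (h : Ends I c m T Q) (hT : T ≤ T') : Ends I c m T' Q := h.mono hT fun _ => id

theorem skip (h : Q m) : Ends I .skip m 1 Q := ⟨m, 1, .skip m, le_rfl, h⟩

theorem setNat {x : ℕ} {i e : NExp} (h : Q (m.setNat x (i.eval I m) (e.eval I m))) :
    Ends I (.setNat x i e) m (i.cost + e.cost + 1) Q := ⟨_, _, .setNat m x i e, le_rfl, h⟩

theorem setReal {x : ℕ} {i : NExp} {e : RExp} (h : Q (m.setReal x (i.eval I m) (e.eval I m))) :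
    Ends I (.setReal x i e) m (i.cost + e.cost + 1) Q := ⟨_, _, .setReal m x i e, le_rfl, h⟩

theorem seq (h : Ends I c m T fun m' => Ends I d m' T' Q) : Ends I (.seq c d) m (T + T') Q := by
  obtain ⟨m₁, t, h, ht, m₂, t', h', ht', hq⟩ := h
  exact ⟨m₂, _, .seq h h', add_le_add ht ht', hq⟩

theorem branch {b : Test} (h : b.Holds I m → Ends I c m T Q) (h' : ¬ b.Holds I m → Ends I d m T' Q) :
    Ends I (.branch b c d) m (b.cost + (T + T') + 1) Q := by
  by_cases hb : b.Holds I m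
  · obtain ⟨m₁, t, h, ht, hq⟩ := h hb
    exact ⟨m₁, _, .branchTrue hb h, by omega, hq⟩
  · obtain ⟨m₁, t, h, ht, hq⟩ := h' hb
    exact ⟨m₁, _, .branchFalse hb h, by omega, hq⟩

/-- The invariant is indexed by a progress counter, and a passed test must force the counter below
`N`; this gives termination and the step bound at once. The counter may start anywhere, as a search
beginning at index 1 requires. -/
theorem loop {b : Test} {N : ℕ} (Inv : ℕ → Memory → Prop)
    (step : ∀ i m, Inv i m → b.Holds I m → i < N ∧ Ends I c m T (Inv (i + 1)))
    {i : ℕ} (h0 : Inv i m) (hQ : ∀ j m', Inv j m' → ¬ b.Holds I m' → Q m') :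
    Ends I (.loop b c) m ((N - i) * (b.cost + T + 1) + (b.cost + 1)) Q := by
  obtain ⟨n, hn⟩ : ∃ n, n = N - i := ⟨_, rfl⟩
  induction n generalizing i m with
  | zero =>
    by_cases hb : b.Holds I m
    · have := (step i m h0 hb).1
      omega
    · exact ⟨m, _, .loopDone hb, by omega, hQ i m h0 hb⟩
  | succ n ih =>
    by_cases hb : b.Holds I m
    · obtain ⟨-, m₁, t, h, ht, hi⟩ := step i m h0 hb
      obtain ⟨m₂, t', h', ht', hq⟩ := ih hi (by omega)
      refine ⟨m₂, _, .loopStep hb h h', ?_, hq⟩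
      rw [← hn, Nat.succ_mul]
      rw [show N - (i + 1) = n by omega] at ht'
      omega
    · exact ⟨m, _, .loopDone hb, by omega, hQ i m h0 hb⟩

end Ends

/-- Run `c` with cell `0` of integer array `v` equal to `0, 1, …, n - 1`. -/
def forLoop (v : ℕ) (n : NExp) (c : Prog) : Prog :=
  .seq (.setNat v (.lit 0) (.lit 0))
    (.loop (.natLe (.add (.get v (.lit 0)) (.lit 1)) n)
      (.seq c (.setNat v (.lit 0) (.add (.get v (.lit 0)) (.lit 1)))))

/-- The body has to hand back the counter unchanged. The invariant must not depend on the counter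
cell, because the increment follows the body. The constant 12 covers test and increment in each
round, and initialisation and final test once. -/
theorem Ends.forLoop {I : Input} {c : Prog} {m : Memory} {T N v : ℕ} {n : NExp} {Q : Memory → Prop}
    (Inv : ℕ → Memory → Prop) (hn : ∀ i m, Inv i m → n.eval I m = N)
    (hv : ∀ i m a, Inv i m → Inv i (m.setNat v 0 a))
    (step : ∀ i < N, ∀ m, Inv i m → m.nat v 0 = i →
      Ends I c m T fun m' => m'.nat v 0 = i ∧ Inv (i + 1) m')
    (h0 : Inv 0 m) (hQ : ∀ m', Inv N m' → Q m') :
    Ends I (forLoop v n c) m (N * (T + n.cost + 12) + n.cost + 12) Q := by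
  have := Ends.seq (I := I) (Q := Q) (d := (.loop (.natLe (.add (.get v (.lit 0)) (.lit 1)) n)
      (.seq c (.setNat v (.lit 0) (.add (.get v (.lit 0)) (.lit 1))))))
    (Ends.setNat (I := I) (m := m) (x := v) (i := .lit 0) (e := .lit 0)
    (Ends.loop (N := N) (i := 0) (T := T + 6) (fun i m => m.nat v 0 = i ∧ i ≤ N ∧ Inv i m)
      ?_ ?_ ?_))
  · refine this.le ?_
    simp only [NExp.cost, Test.cost, Nat.sub_zero]
    have : N * (1 + 1 + 1 + 1 + n.cost + 1 + (T + 6) + 1) = N * (T + n.cost + 12) := by ring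
    omega
  · rintro i m ⟨hi, -, h⟩ hb
    simp only [Test.Holds, NExp.eval, hi, hn i m h] at hb
    refine ⟨hb, Ends.le (Ends.seq ((step i hb m h hi).mono le_rfl
      fun m' h' => Ends.setNat ⟨?_, ?_, ?_⟩)) ?_⟩
    · simp [NExp.eval, h'.1]
    · exact hb
    · exact hv _ _ _ h'.2
    · simp [NExp.cost]
  · exact ⟨by simp [NExp.eval], Nat.zero_le _, hv _ _ _ h0⟩
  · rintro j m' ⟨hj, hle, h⟩ hb
    simp only [Test.Holds, NExp.eval, hj, hn j m' h] at hb
    obtain rfl : j = N := by omega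
    exact hQ _ h

end RealRAM

/-! ### Cuts of weights with a relaxed triangle inequality -/

section CutEstimates

open Finset

variable {T : Type*}

/-- The total weight between two sets. -/
def cutWeight (f : T → T → ℝ) (A B : Finset T) : ℝ := ∑ a ∈ A, ∑ b ∈ B, f a b

/-- The total weight at a point. -/
def pointWeight [Fintype T] (f : T → T → ℝ) (u : T) : ℝ := ∑ v, f u v

theorem cutWeight_nonneg {f : T → T → ℝ} (hf : ∀ x y, 0 ≤ f x y) (A B : Finset T) :
    0 ≤ cutWeight f A B := sum_nonneg fun _ _ => sum_nonneg fun _ _ => hf _ _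

theorem cutWeight_comm {f : T → T → ℝ} (hs : ∀ x y, f x y = f y x) (A B : Finset T) :
    cutWeight f A B = cutWeight f B A := by
  unfold cutWeight
  rw [sum_comm]
  exact sum_congr rfl fun _ _ => sum_congr rfl fun _ _ => hs _ _

theorem cutWeight_filter_left (f : T → T → ℝ) (p : T → Prop) [DecidablePred p] (A B : Finset T) :
    cutWeight f A B = cutWeight f {a ∈ A | p a} B + cutWeight f {a ∈ A | ¬ p a} B :=
  (sum_filter_add_sum_filter_not A p _).symm

theorem cutWeight_filter_right {f : T → T → ℝ} (hs : ∀ x y, f x y = f y x) (p : T → Prop)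
    [DecidablePred p] (A B : Finset T) :
    cutWeight f A B = cutWeight f A {b ∈ B | p b} + cutWeight f A {b ∈ B | ¬ p b} := by
  rw [cutWeight_comm hs, cutWeight_filter_left f p, cutWeight_comm hs, cutWeight_comm hs _ A]

theorem pointWeight_nonneg [Fintype T] {f : T → T → ℝ} (hf : ∀ x y, 0 ≤ f x y) (u : T) :
    0 ≤ pointWeight f u := sum_nonneg fun _ _ => hf _ _

theorem sum_pointWeight_le [Fintype T] {f : T → T → ℝ} (hf : ∀ x y, 0 ≤ f x y) (A : Finset T) :
    ∑ a ∈ A, pointWeight f a ≤ ∑ a, pointWeight f a :=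
  sum_le_univ_sum_of_nonneg fun _ => pointWeight_nonneg hf _

/-- The relaxed inequality summed over the middle point. In `pointWeight_le` it is summed over an
endpoint, which gives the converse estimate: for a point of large weight, f(u,v) is about w(u)/k for
typical v. -/
theorem card_mul_le [Fintype T] {f : T → T → ℝ} {a b : ℝ} (hs : ∀ x y, f x y = f y x)
    (h : ∀ x y z, f x z ≤ a * f x y + b * f y z) (u v : T) :
    Fintype.card T * f u v ≤ a * pointWeight f u + b * pointWeight f v := by
  calc (Fintype.card T : ℝ) * f u v = ∑ _x : T, f u v := by simp
    _ ≤ ∑ x, (a * f u x + b * f v x) := sum_le_sum fun x _ => by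
        have := h u x v
        rwa [hs x v] at this
    _ = _ := by simp only [sum_add_distrib, mul_sum, pointWeight]

theorem pointWeight_le [Fintype T] {f : T → T → ℝ} {a b : ℝ}
    (h : ∀ x y z, f x z ≤ a * f x y + b * f y z) (u v : T) :
    pointWeight f u ≤ a * (Fintype.card T * f u v) + b * pointWeight f v := by
  calc pointWeight f u ≤ ∑ x, (a * f u v + b * f v x) := sum_le_sum fun x _ => h u v x
    _ = _ := by simp only [sum_add_distrib, mul_sum, pointWeight]; simp; ring

/-- Meant for a small set `G` of heavy points on one side and the whole opposite side `R`, with k/2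
points and `a` close to 1. The first term is then about half the weight of `G`; the second is an
error, small because `G` has few points. The next lemma is the reverse estimate. -/
theorem card_mul_cutWeight_le [Fintype T] {f : T → T → ℝ} {a b : ℝ} (hs : ∀ x y, f x y = f y x)
    (h : ∀ x y z, f x z ≤ a * f x y + b * f y z) (G R : Finset T) :
    Fintype.card T * cutWeight f G R ≤
      a * (#R * ∑ u ∈ G, pointWeight f u) + b * (#G * ∑ v ∈ R, pointWeight f v) := by
  calc (Fintype.card T : ℝ) * cutWeight f G R
      = ∑ u ∈ G, ∑ v ∈ R, Fintype.card T * f u v := by simp only [cutWeight, mul_sum]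
    _ ≤ ∑ u ∈ G, ∑ v ∈ R, (a * pointWeight f u + b * pointWeight f v) :=
        sum_le_sum fun u _ => sum_le_sum fun v _ => card_mul_le hs h u v
    _ = _ := by
        simp only [sum_add_distrib, sum_const, nsmul_eq_mul, mul_sum]
        congr 1 <;> exact sum_congr rfl fun _ _ => by ring

theorem card_mul_sum_pointWeight_le [Fintype T] {f : T → T → ℝ} {a b : ℝ}
    (h : ∀ x y z, f x z ≤ a * f x y + b * f y z) (G R : Finset T) :
    #R * ∑ u ∈ G, pointWeight f u ≤
      a * (Fintype.card T * cutWeight f G R) + b * (#G * ∑ v ∈ R, pointWeight f v) := by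
  calc (#R : ℝ) * ∑ u ∈ G, pointWeight f u
      = ∑ u ∈ G, ∑ v ∈ R, pointWeight f u := by simp [mul_sum]
    _ ≤ ∑ u ∈ G, ∑ v ∈ R, (a * (Fintype.card T * f u v) + b * pointWeight f v) :=
        sum_le_sum fun u _ => sum_le_sum fun v _ => pointWeight_le h u v
    _ = _ := by
        simp only [cutWeight, sum_add_distrib, sum_const, nsmul_eq_mul, mul_sum]
        congr 1
        exact sum_congr rfl fun _ _ => by ring

/-- In a balanced bipartition, the cut carries a constant fraction of the total weight. -/
theorem sum_pointWeight_le_cutWeight [Fintype T] [DecidableEq T] {f : T → T → ℝ} {K : ℝ}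
    (hs : ∀ x y, f x y = f y x) (h : ∀ x y z, f x z ≤ K * f x y + K * f y z) {n : ℕ} (hn : 0 < n)
    {L : Finset T} (hL : #L = n) (hR : #Lᶜ = n) :
    ∑ u, pointWeight f u ≤ (2 + 4 * K) * cutWeight f L Lᶜ := by
  -- Every pair inside `A` is routed through all points of `B` and averaged; equal cardinalities
  -- make the factor free of `n`.
  have within : ∀ A B : Finset T, #A = n → #B = n → cutWeight f A A ≤ 2 * K * cutWeight f A B := by
    intro A B hA hB
    have hn' : (0 : ℝ) < n := by exact_mod_cast hn
    refine le_of_mul_le_mul_left ?_ hn'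
    calc (n : ℝ) * cutWeight f A A = ∑ x ∈ A, ∑ z ∈ A, ∑ _y ∈ B, f x z := by
          simp [cutWeight, mul_sum, hB]
      _ ≤ ∑ x ∈ A, ∑ z ∈ A, ∑ y ∈ B, (K * f x y + K * f z y) :=
          sum_le_sum fun x _ => sum_le_sum fun z _ => sum_le_sum fun y _ => by
            rw [hs z y]; exact h x y z
      _ = n * (2 * K * cutWeight f A B) := by
          simp only [sum_add_distrib, sum_const, nsmul_eq_mul, cutWeight, ← mul_sum, hA]
          ring
  have e : ∑ u, pointWeight f u = cutWeight f L L + cutWeight f L Lᶜ +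
      (cutWeight f Lᶜ L + cutWeight f Lᶜ Lᶜ) := by
    rw [← sum_add_sum_compl L]
    simp only [pointWeight, cutWeight, ← sum_add_distrib, sum_add_sum_compl]
  have h1 := within L Lᶜ hL hR
  have h2 := within Lᶜ L hR hL
  rw [cutWeight_comm hs Lᶜ L] at h2 e
  linarith

/-- Equal fibre counts mean that the two sets have the same multiset of labels. -/
theorem sum_comp_eq_of_card_eq {M : Type*} [AddCommMonoid M] {κ : T → ℕ} {A A' : Finset T}
    (h : ∀ c, #{u ∈ A | κ u = c} = #{u ∈ A' | κ u = c}) (g : ℕ → M) :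
    ∑ u ∈ A, g (κ u) = ∑ u ∈ A', g (κ u) := by
  have key : A.val.map κ = A'.val.map κ := by
    ext c
    rw [Multiset.count_map, Multiset.count_map]
    have := h c
    simp only [Finset.card, Finset.filter_val] at this
    simpa only [eq_comm] using this
  have : ((A.val.map κ).map g).sum = ((A'.val.map κ).map g).sum := by rw [key]
  rwa [Multiset.map_map, Multiset.map_map] at this

theorem cutWeight_comp_eq {κ : T → ℕ} {A A' B B' : Finset T}
    (h : ∀ c, #{u ∈ A | κ u = c} = #{u ∈ A' | κ u = c})
    (h' : ∀ c, #{u ∈ B | κ u = c} = #{u ∈ B' | κ u = c}) (g : ℕ → ℕ → ℝ) :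
    cutWeight (fun u v => g (κ u) (κ v)) A B = cutWeight (fun u v => g (κ u) (κ v)) A' B' := by
  unfold cutWeight
  rw [sum_comp_eq_of_card_eq h fun c => ∑ b ∈ B, g c (κ b)]
  exact sum_congr rfl fun u _ => sum_comp_eq_of_card_eq h' _

theorem card_filter_eq_of_ne {κ : T → ℕ} {A A' : Finset T}
    (h : ∀ c, #{u ∈ A | κ u = c} = #{u ∈ A' | κ u = c}) (c : ℕ) :
    #{u ∈ {u ∈ A | ¬ κ u = 0} | κ u = c} = #{u ∈ {u ∈ A' | ¬ κ u = 0} | κ u = c} := by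
  simp only [filter_filter]
  by_cases hc : c = 0
  · subst hc
    simp
  · have : ∀ A : Finset T, {u ∈ A | ¬ κ u = 0 ∧ κ u = c} = {u ∈ A | κ u = c} := fun A =>
      filter_congr fun u _ => ⟨fun h => h.2, fun h => ⟨h ▸ hc, h⟩⟩
    rw [this, this, h]

theorem card_filter_compl_eq [Fintype T] [DecidableEq T] {κ : T → ℕ} {A A' : Finset T}
    (h : ∀ c, #{u ∈ A | κ u = c} = #{u ∈ A' | κ u = c}) (c : ℕ) :
    #{u ∈ Aᶜ | κ u = c} = #{u ∈ A'ᶜ | κ u = c} := by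
  have key : ∀ A : Finset T, #{u ∈ A | κ u = c} + #{u ∈ Aᶜ | κ u = c} = #{u : T | κ u = c} := by
    intro A
    simp only [card_filter]
    exact sum_add_sum_compl A _
  have := key A
  have := key A'
  have := h c
  omega

theorem cutWeight_le_add {f g : T → T → ℝ} {a b : ℝ} {A B : Finset T}
    (h : ∀ x ∈ A, ∀ y ∈ B, f x y ≤ a * g x y + b) :
    cutWeight f A B ≤ a * cutWeight g A B + b * (#A * #B) := by
  calc cutWeight f A B ≤ ∑ x ∈ A, ∑ y ∈ B, (a * g x y + b) :=
        sum_le_sum fun x hx => sum_le_sum fun y hy => h x hx y hy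
    _ = _ := by
        simp only [sum_add_distrib, sum_const, nsmul_eq_mul, cutWeight, mul_sum]
        ring

/-- After both ends of each pair are moved to their centers, the near part of the cut depends on the
counts only, so it agrees for `L` and `L'`. Each passage costs a factor (1+η)² and at most 3Bθ per
pair. Passing to the centers and back gives (1+η)⁴ ≤ 1+15η and 3(1+(1+η)²) ≤ 15. -/
theorem near_cutWeight_le [Fintype T] [DecidableEq T] {f : T → T → ℝ} {η B θ : ℝ}
    (hf : ∀ x y, 0 ≤ f x y) (hs : ∀ x y, f x y = f y x) (hη0 : 0 ≤ η) (hη1 : η ≤ 1) (hB : 0 ≤ B)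
    (h : ∀ x y z, f x z ≤ (1 + η) * f x y + B * f y z) {κ : T → ℕ} {ρ : ℕ → T}
    (hρ : ∀ u, κ u ≠ 0 → f u (ρ (κ u)) ≤ θ) (hθ : 0 ≤ θ) {n : ℕ} {L L' : Finset T}
    (hL : #L = n) (hL' : #L' = n) (hR : #Lᶜ = n) (hR' : #L'ᶜ = n)
    (hκ : ∀ c, #{u ∈ L | κ u = c} = #{u ∈ L' | κ u = c}) :
    cutWeight f {u ∈ L | ¬ κ u = 0} {u ∈ Lᶜ | ¬ κ u = 0} ≤
      (1 + 15 * η) * cutWeight f {u ∈ L' | ¬ κ u = 0} {u ∈ L'ᶜ | ¬ κ u = 0}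
        + 15 * B * θ * n ^ 2 := by
  have hBθ : 0 ≤ B * θ := mul_nonneg hB hθ
  have p1 : ∀ x, κ x ≠ 0 → ∀ y, κ y ≠ 0 →
      f x y ≤ (1 + η) ^ 2 * f (ρ (κ x)) (ρ (κ y)) + 3 * B * θ := by
    intro x hx y hy
    have h1 := h x (ρ (κ y)) y
    have h2 := h (ρ (κ y)) (ρ (κ x)) x
    rw [hs (ρ (κ y)) x, hs (ρ (κ y)) (ρ (κ x)), hs (ρ (κ x)) x] at h2
    rw [hs (ρ (κ y)) y] at h1
    have h3 := mul_le_mul_of_nonneg_left (hρ x hx) hB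
    have h4 := mul_le_mul_of_nonneg_left (hρ y hy) hB
    have h5 := mul_le_mul_of_nonneg_left (h2.trans (add_le_add_right h3 _))
      (by linarith : 0 ≤ 1 + η)
    nlinarith
  have p2 : ∀ x, κ x ≠ 0 → ∀ y, κ y ≠ 0 →
      f (ρ (κ x)) (ρ (κ y)) ≤ (1 + η) ^ 2 * f x y + 3 * B * θ := by
    intro x hx y hy
    have h1 := h (ρ (κ x)) y (ρ (κ y))
    have h2 := h y x (ρ (κ x))
    rw [hs y x, hs y (ρ (κ x))] at h2
    have h3 := mul_le_mul_of_nonneg_left (hρ x hx) hB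
    have h4 := mul_le_mul_of_nonneg_left (hρ y hy) hB
    have h5 := mul_le_mul_of_nonneg_left (h2.trans (add_le_add_right h3 _))
      (by linarith : 0 ≤ 1 + η)
    nlinarith
  have c1 : ∀ A : Finset T, #A = n → (#{u ∈ A | ¬ κ u = 0} : ℝ) ≤ n := fun A hA => by
    exact_mod_cast hA ▸ card_filter_le _ _
  have c2 : ∀ A B : Finset T, #A = n → #B = n →
      (#{u ∈ A | ¬ κ u = 0} * #{u ∈ B | ¬ κ u = 0} : ℝ) ≤ n ^ 2 := fun A B hA hB => by
    rw [sq]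
    exact mul_le_mul (c1 A hA) (c1 B hB) (Nat.cast_nonneg _) (Nat.cast_nonneg _)
  have e1 := cutWeight_le_add (f := f) (g := fun x y => f (ρ (κ x)) (ρ (κ y)))
    (A := {u ∈ L | ¬ κ u = 0}) (B := {u ∈ Lᶜ | ¬ κ u = 0})
    fun x hx y hy => p1 x (mem_filter.1 hx).2 y (mem_filter.1 hy).2
  have e2 := cutWeight_le_add (g := f) (f := fun x y => f (ρ (κ x)) (ρ (κ y)))
    (A := {u ∈ L' | ¬ κ u = 0}) (B := {u ∈ L'ᶜ | ¬ κ u = 0})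
    fun x hx y hy => p2 x (mem_filter.1 hx).2 y (mem_filter.1 hy).2
  rw [cutWeight_comp_eq (card_filter_eq_of_ne hκ) (card_filter_eq_of_ne (card_filter_compl_eq hκ))
    fun c c' => f (ρ c) (ρ c')] at e1
  set N := cutWeight f {u ∈ L | ¬ κ u = 0} {u ∈ Lᶜ | ¬ κ u = 0}
  set N' := cutWeight f {u ∈ L' | ¬ κ u = 0} {u ∈ L'ᶜ | ¬ κ u = 0} with hN'
  set M := cutWeight (fun x y => f (ρ (κ x)) (ρ (κ y))) {u ∈ L' | ¬ κ u = 0} {u ∈ L'ᶜ | ¬ κ u = 0}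
  have hN0 : 0 ≤ N' := cutWeight_nonneg hf _ _
  have g1 := mul_le_mul_of_nonneg_left (c2 L Lᶜ hL hR) (by linarith : 0 ≤ 3 * B * θ)
  have g2 := mul_le_mul_of_nonneg_left (c2 L' L'ᶜ hL' hR') (by linarith : 0 ≤ 3 * B * θ)
  have hn2 : 0 ≤ B * θ * (n : ℝ) ^ 2 := by positivity
  have q1 : (1 + η) ^ 2 ≤ 4 := by nlinarith
  have q2 : (1 + η) ^ 2 * (1 + η) ^ 2 ≤ 1 + 15 * η := by
    have a2 : η ^ 2 ≤ η := by nlinarith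
    have a3 : η ^ 3 ≤ η := by nlinarith [pow_nonneg hη0 2]
    have a4 : η ^ 4 ≤ η := by nlinarith [pow_nonneg hη0 3]
    nlinarith
  have s1 : M ≤ (1 + η) ^ 2 * N' + 3 * B * θ * n ^ 2 := e2.trans (by linarith)
  have s2 := mul_le_mul_of_nonneg_left s1 (sq_nonneg (1 + η))
  have s3 := mul_le_mul_of_nonneg_right q2 hN0
  have s4 := mul_le_mul_of_nonneg_right q1 hn2
  nlinarith

theorem sum_filter_add_sum_compl_filter [Fintype T] [DecidableEq T] (p : T → Prop)
    [DecidablePred p] (A : Finset T) (g : T → ℝ) :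
    ∑ u ∈ A with p u, g u + ∑ u ∈ Aᶜ with p u, g u = ∑ u with p u, g u := by
  simp only [sum_filter]
  exact sum_add_sum_compl A _

theorem card_filter_add_card_compl_filter [Fintype T] [DecidableEq T] (p : T → Prop)
    [DecidablePred p] (A : Finset T) :
    (#{u ∈ A | p u} : ℝ) + #{u ∈ Aᶜ | p u} = #{u : T | p u} := by
  simpa using sum_filter_add_sum_compl_filter p A fun _ => 1

theorem card_eq_two_mul [Fintype T] [DecidableEq T] {n : ℕ} {L : Finset T} (hL : #L = n)
    (hR : #Lᶜ = n) : (Fintype.card T : ℝ) = 2 * n := by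
  have := card_add_card_compl L
  rw [hL, hR] at this
  rw [← this]; push_cast; ring

/-- The part of a cut that involves the points satisfying `p` is at most about half of their
weight. -/
theorem cutWeight_le_near_add [Fintype T] [DecidableEq T] {f : T → T → ℝ} {η B δ : ℝ}
    (hf : ∀ x y, 0 ≤ f x y) (hs : ∀ x y, f x y = f y x) (hB : 0 ≤ B)
    (h : ∀ x y z, f x z ≤ (1 + η) * f x y + B * f y z) (p : T → Prop) [DecidablePred p]
    (hF : (#{u : T | p u} : ℝ) * (∑ v, pointWeight f v) / Fintype.card T ≤ δ) {n : ℕ} (hn : 0 < n)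
    {L : Finset T} (hL : #L = n) (hR : #Lᶜ = n) :
    cutWeight f L Lᶜ ≤ cutWeight f {u ∈ L | ¬ p u} {u ∈ Lᶜ | ¬ p u} +
      (1 + η) / 2 * (∑ u with p u, pointWeight f u) + B * δ := by
  have hk : (Fintype.card T : ℝ) = 2 * n := card_eq_two_mul hL hR
  have hn' : (0 : ℝ) < n := by exact_mod_cast hn
  have hk0 : (0 : ℝ) < Fintype.card T := by rw [hk]; linarith
  have sumC : ∀ A : Finset T, ∑ u ∈ A, pointWeight f u ≤ ∑ v, pointWeight f v :=
    sum_pointWeight_le hf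
  set S := ∑ v, pointWeight f v
  set W := ∑ u with p u, pointWeight f u with hW
  set F : ℝ := (#{u : T | p u} : ℝ) with hFd
  -- The remaining part of the cut is the sum of the two cuts between the points with `p` on one
  -- side and the entire other side, less the pairs with `p` at both ends. Dropping that subtraction
  -- is harmless for an upper bound.
  have d1 := cutWeight_filter_left f (fun u => p u) L Lᶜ
  have d2 := cutWeight_filter_right hs (fun u => p u) {u ∈ L | ¬ p u} Lᶜ
  have d3 := cutWeight_filter_left f (fun u => p u) L {u ∈ Lᶜ | p u}
  have d4 := cutWeight_nonneg hf {u ∈ L | p u} {u ∈ Lᶜ | p u}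
  have d5 := card_mul_cutWeight_le hs h {u ∈ L | p u} Lᶜ
  have d6 := card_mul_cutWeight_le hs h {u ∈ Lᶜ | p u} L
  rw [cutWeight_comm hs _ L] at d6
  rw [hR] at d5
  rw [hL] at d6
  have m1 := mul_le_mul_of_nonneg_left (mul_le_mul_of_nonneg_left (sumC Lᶜ)
    (Nat.cast_nonneg (α := ℝ) #{u ∈ L | p u})) hB
  have m2 := mul_le_mul_of_nonneg_left (mul_le_mul_of_nonneg_left (sumC L)
    (Nat.cast_nonneg (α := ℝ) #{u ∈ Lᶜ | p u})) hB
  have s1 := sum_filter_add_sum_compl_filter p L (pointWeight f)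
  have s2 := card_filter_add_card_compl_filter p L
  have t1 : Fintype.card T * (cutWeight f {u ∈ L | p u} Lᶜ +
      cutWeight f L {u ∈ Lᶜ | p u}) ≤ (1 + η) * n * W + B * F * S := by
    rw [hFd, ← s2, hW, ← s1]
    linarith
  have t2 : cutWeight f {u ∈ L | p u} Lᶜ + cutWeight f L {u ∈ Lᶜ | p u} ≤
      (1 + η) / 2 * W + B * (F * S / Fintype.card T) := by
    refine le_of_mul_le_mul_left (t1.trans (le_of_eq ?_)) hk0
    rw [hk]; field_simp
  have t3 := mul_le_mul_of_nonneg_left hF hB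
  linarith

/-- The part of a cut that involves the points satisfying `p` is at least about half of their
weight. -/
theorem sum_pointWeight_le_sub_near [Fintype T] [DecidableEq T] {f : T → T → ℝ} {η B K δ : ℝ}
    (hf : ∀ x y, 0 ≤ f x y) (hs : ∀ x y, f x y = f y x) (hη1 : η ≤ 1) (hK : 0 ≤ K)
    (hB : 0 ≤ B) (h : ∀ x y z, f x z ≤ (1 + η) * f x y + B * f y z)
    (h' : ∀ x y z, f x z ≤ K * f x y + K * f y z) (p : T → Prop) [DecidablePred p]
    (hF : (#{u : T | p u} : ℝ) * (∑ v, pointWeight f v) / Fintype.card T ≤ δ) {n : ℕ} (hn : 0 < n)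
    {L : Finset T} (hL : #L = n) (hR : #Lᶜ = n) :
    (∑ u with p u, pointWeight f u) / 2 ≤ (1 + η) * (cutWeight f L Lᶜ -
      cutWeight f {u ∈ L | ¬ p u} {u ∈ Lᶜ | ¬ p u}) + (2 * K + B) * δ := by
  have hk : (Fintype.card T : ℝ) = 2 * n := card_eq_two_mul hL hR
  have hn' : (0 : ℝ) < n := by exact_mod_cast hn
  have hk0 : (0 : ℝ) < Fintype.card T := by rw [hk]; linarith
  have sumC : ∀ A : Finset T, ∑ u ∈ A, pointWeight f u ≤ ∑ v, pointWeight f v :=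
    sum_pointWeight_le hf
  set S := ∑ v, pointWeight f v
  set W := ∑ u with p u, pointWeight f u with hW
  set F : ℝ := (#{u : T | p u} : ℝ) with hFd
  have d1 := cutWeight_filter_left f (fun u => p u) L Lᶜ
  have d2 := cutWeight_filter_right hs (fun u => p u) {u ∈ L | ¬ p u} Lᶜ
  have d3 := cutWeight_filter_left f (fun u => p u) L {u ∈ Lᶜ | p u}
  have d4 := card_mul_cutWeight_le hs h' {u ∈ L | p u} {u ∈ Lᶜ | p u}
  have d5 := card_mul_sum_pointWeight_le h {u ∈ L | p u} Lᶜ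
  have d6 := card_mul_sum_pointWeight_le h {u ∈ Lᶜ | p u} L
  rw [cutWeight_comm hs _ L] at d6
  rw [hR] at d5
  rw [hL] at d6
  have m1 := mul_le_mul_of_nonneg_left (mul_le_mul_of_nonneg_left (sumC Lᶜ)
    (Nat.cast_nonneg (α := ℝ) #{u ∈ L | p u})) hB
  have m2 := mul_le_mul_of_nonneg_left (mul_le_mul_of_nonneg_left (sumC L)
    (Nat.cast_nonneg (α := ℝ) #{u ∈ Lᶜ | p u})) hB
  have m3 := mul_le_mul_of_nonneg_left (mul_le_mul_of_nonneg_left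
    (sumC {u ∈ Lᶜ | p u}) (Nat.cast_nonneg (α := ℝ) #{u ∈ L | p u}))
    hK
  have m4 := mul_le_mul_of_nonneg_left (mul_le_mul_of_nonneg_left
    (sumC {u ∈ L | p u}) (Nat.cast_nonneg (α := ℝ) #{u ∈ Lᶜ | p u}))
    hK
  have s1 := sum_filter_add_sum_compl_filter p L (pointWeight f)
  have s2 := card_filter_add_card_compl_filter p L
  set FF := cutWeight f {u ∈ L | p u} {u ∈ Lᶜ | p u} with hFF
  have hFF0 : 0 ≤ FF := cutWeight_nonneg hf _ _
  -- For a lower bound the doubly counted pairs, with `p` at both ends, do matter. The crude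
  -- inequality with constant `K` suffices for them.
  have t0 : FF ≤ K * (F * S / Fintype.card T) := by
    have : Fintype.card T * FF ≤ K * F * S := by rw [hFd, ← s2]; linarith
    refine le_of_mul_le_mul_left (this.trans (le_of_eq ?_)) hk0
    field_simp
  have t1 : n * W ≤ (1 + η) * (Fintype.card T * (cutWeight f {u ∈ L | p u} Lᶜ +
      cutWeight f L {u ∈ Lᶜ | p u})) + B * F * S := by
    rw [hFd, ← s2, hW, ← s1]
    linarith
  have t2 : W / 2 ≤ (1 + η) * (cutWeight f {u ∈ L | p u} Lᶜ +
      cutWeight f L {u ∈ Lᶜ | p u}) + B * (F * S / Fintype.card T) := by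
    refine le_of_mul_le_mul_left ((le_of_eq ?_).trans (t1.trans (le_of_eq ?_))) hk0
    · rw [hk]; ring
    · field_simp
  have t3 := mul_le_mul_of_nonneg_left hF hB
  have t4 := mul_le_mul_of_nonneg_left hF hK
  have t5 : (1 + η) * FF ≤ 2 * (K * (δ)) := by nlinarith
  have t6 : cutWeight f {u ∈ L | p u} Lᶜ + cutWeight f L {u ∈ Lᶜ | p u} =
      (cutWeight f L Lᶜ - cutWeight f {u ∈ L | ¬ p u} {u ∈ Lᶜ | ¬ p u}) + FF := by
    linarith
  rw [t6] at t2
  linarith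

/-- Two balanced bipartitions that split every cluster in the same numbers have almost the same
value, if the clusters other than the cluster `0` are small and the points of the cluster `0` are
far from most points. -/
theorem cutWeight_le_of_card_eq [Fintype T] [DecidableEq T] {f : T → T → ℝ} {η B K X : ℝ}
    (hf : ∀ x y, 0 ≤ f x y) (hs : ∀ x y, f x y = f y x) (hη0 : 0 ≤ η) (hη1 : η ≤ 1) (hK : 1 ≤ K)
    (hKB : K ≤ B) (hX : 0 < X) (h : ∀ x y z, f x z ≤ (1 + η) * f x y + B * f y z)
    (h' : ∀ x y z, f x z ≤ K * f x y + K * f y z) {κ : T → ℕ} {ρ : ℕ → T}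
    (hρ : ∀ u, κ u ≠ 0 → X * (Fintype.card T : ℝ) ^ 2 * f u (ρ (κ u)) ≤ ∑ v, pointWeight f v)
    (hfar : ∀ u, κ u = 0 → X * ∑ v, pointWeight f v ≤ Fintype.card T * pointWeight f u)
    {n : ℕ} (hn : 0 < n) {L L' : Finset T}
    (hL : #L = n) (hL' : #L' = n) (hR : #Lᶜ = n) (hR' : #L'ᶜ = n)
    (hκ : ∀ c, #{u ∈ L | κ u = c} = #{u ∈ L' | κ u = c}) :
    cutWeight f L Lᶜ ≤ (1 + 15 * η + 66 * (B * K) / X) * cutWeight f L' L'ᶜ := by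
  have hB : 0 ≤ B := by linarith
  have hk : (Fintype.card T : ℝ) = 2 * n := card_eq_two_mul hL hR
  have hn' : (0 : ℝ) < n := by exact_mod_cast hn
  have hk0 : (0 : ℝ) < Fintype.card T := by rw [hk]; linarith
  set S := ∑ v, pointWeight f v with hS
  have hS0 : 0 ≤ S := sum_nonneg fun _ _ => pointWeight_nonneg hf _
  have sumC : ∀ A : Finset T, ∑ u ∈ A, pointWeight f u ≤ S := sum_pointWeight_le hf
  have near := near_cutWeight_le (θ := S / (X * (Fintype.card T : ℝ) ^ 2)) hf hs hη0 hη1 hB h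
    (fun u hu => by
      rw [le_div_iff₀ (by positivity), mul_comm]
      exact hρ u hu) (by positivity) hL hL' hR hR' hκ
  have hθ : 15 * B * (S / (X * (Fintype.card T : ℝ) ^ 2)) * n ^ 2 = 15 / 4 * (B * S / X) := by
    rw [hk]; field_simp; norm_num
  rw [hθ] at near
  -- Markov's inequality: the weights sum to S, and each far point has weight at least XS/k. Keeping
  -- the factor S includes the case S = 0.
  have hF : (#{u : T | κ u = 0} : ℝ) * S / Fintype.card T ≤ S / X := by
    rw [div_le_div_iff₀ hk0 hX]
    calc (#{u : T | κ u = 0} : ℝ) * S * X = ∑ u with κ u = 0, X * S := by simp; ring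
      _ ≤ ∑ u with κ u = 0, Fintype.card T * pointWeight f u :=
          sum_le_sum fun u hu => hfar u (mem_filter.1 hu).2
      _ = Fintype.card T * ∑ u with κ u = 0, pointWeight f u := by rw [mul_sum]
      _ ≤ S * Fintype.card T := by
          rw [mul_comm]; exact mul_le_mul_of_nonneg_right (sumC _) hk0.le
  have up := cutWeight_le_near_add hf hs hB h (fun u => κ u = 0) hF hn hL hR
  have low := sum_pointWeight_le_sub_near hf hs hη1 (by linarith) hB h h' (fun u => κ u = 0) hF
    hn hL' hR'
  set W := ∑ u with κ u = 0, pointWeight f u with hW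
  have hW0 : 0 ≤ W := sum_nonneg fun _ _ => pointWeight_nonneg hf _
  have tot := sum_pointWeight_le_cutWeight hs h' hn hL' hR'
  rw [← hS] at tot
  set C' := cutWeight f L' L'ᶜ with hC'
  set N' := cutWeight f {u ∈ L' | ¬ κ u = 0} {u ∈ L'ᶜ | ¬ κ u = 0} with hN'
  have hN'0 : 0 ≤ N' := cutWeight_nonneg hf _ _
  have hC'N' : N' ≤ C' := by
    have d1 := cutWeight_filter_left f (fun u => κ u = 0) L' L'ᶜ
    have d2 := cutWeight_filter_right hs (fun u => κ u = 0) {u ∈ L' | ¬ κ u = 0} L'ᶜ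
    have d3 := cutWeight_nonneg hf {u ∈ L' | κ u = 0} L'ᶜ
    have d4 := cutWeight_nonneg hf {u ∈ L' | ¬ κ u = 0} {u ∈ L'ᶜ | κ u = 0}
    linarith
  have hSX : 0 ≤ S / X := by positivity
  have low2 : (1 + η) / 2 * W ≤ (1 + 3 * η) * (C' - N') + 2 * (2 * K + B) * (S / X) := by
    have a1 := mul_le_mul_of_nonneg_left low (by linarith : 0 ≤ 1 + η)
    have a2 : (1 + η) * (1 + η) ≤ 1 + 3 * η := by nlinarith
    have a3 := mul_le_mul_of_nonneg_right a2 (sub_nonneg.2 hC'N')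
    have a4 : (1 + η) * ((2 * K + B) * (S / X)) ≤ 2 * ((2 * K + B) * (S / X)) :=
      mul_le_mul_of_nonneg_right (by linarith) (by positivity)
    linarith
  have b1 : η * (C' - N') ≥ 0 := mul_nonneg hη0 (sub_nonneg.2 hC'N')
  have b2 : K * (S / X) ≤ B * (S / X) := mul_le_mul_of_nonneg_right hKB hSX
  have b3 : B * S / X = B * (S / X) := by ring
  have b4 : B * (S / X) ≤ B * (6 * K * C' / X) := by
    refine mul_le_mul_of_nonneg_left (div_le_div_of_nonneg_right ?_ hX.le) hB
    nlinarith
  -- In units of B·S/X, the errors are 15/4 from the near pairs, 1 from the upper bound, and at most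
  -- 6 from the lower bound since 2(2K+B) ≤ 6B. They total less than 11, and S ≤ (2+4K)·C' ≤ 6K·C'
  -- turns 11 into 66.
  have b5 : 66 * (B * K) / X * C' = 11 * (B * (6 * K * C' / X)) := by ring
  have b6 : 0 ≤ B * (S / X) := mul_nonneg hB hSX
  rw [b3] at near
  rw [add_mul, b5]
  linarith

end CutEstimates

/-! ### Powers of distances and nets in doubling spaces -/

section Metric

open Finset

/-- One of the two terms already suffices, according to whether `b ≤ t * a` or not. -/
theorem add_rpow_le_of_pos {a b t q : ℝ} (ha : 0 ≤ a) (hb : 0 ≤ b) (ht : 0 < t) (hq : 0 ≤ q) :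
    (a + b) ^ q ≤ (1 + t) ^ q * a ^ q + (1 + 1 / t) ^ q * b ^ q := by
  have ht' : 0 < 1 / t := by positivity
  have p1 : 0 ≤ (1 + t) ^ q * a ^ q := by positivity
  have p2 : 0 ≤ (1 + 1 / t) ^ q * b ^ q := by positivity
  rcases le_total b (t * a) with h | h
  · have : (a + b) ^ q ≤ (1 + t) ^ q * a ^ q := by
      rw [← Real.mul_rpow (by positivity) ha]
      exact Real.rpow_le_rpow (by positivity) (by linarith) hq
    linarith
  · have h' : a ≤ 1 / t * b := by
      rw [div_mul_eq_mul_div, one_mul, le_div_iff₀ ht]; linarith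
    have : (a + b) ^ q ≤ (1 + 1 / t) ^ q * b ^ q := by
      rw [← Real.mul_rpow (by positivity) hb]
      exact Real.rpow_le_rpow (by positivity) (by linarith) hq
    linarith

/-- By convexity the graph lies below its chord over [1, 2]. -/
theorem one_add_rpow_le {t q : ℝ} (ht0 : 0 ≤ t) (ht1 : t ≤ 1) (hq : 1 ≤ q) :
    (1 + t) ^ q ≤ 1 + 2 ^ q * t := by
  have := (convexOn_rpow hq).2 (x := 1) (y := 2) (by simp) (by simp)
    (sub_nonneg.2 ht1) ht0 (by ring)
  simp only [smul_eq_mul, Real.one_rpow] at this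
  rw [show (1 - t) * 1 + t * 2 = 1 + t by ring] at this
  linarith

/-- The constant `(1 + 1 / t) ^ q` for the value of `t` used with error parameter `ε`. -/
noncomputable def slack (q ε : ℝ) : ℝ := (1 + 45 * 2 ^ q * ((1 + ε) / ε)) ^ q

/-- The resolution of the clustering used with error parameter `ε`. -/
noncomputable def resolution (q ε : ℝ) : ℝ := 100 * slack q ε * 2 ^ q / ε

theorem two_rpow_le_slack {q ε : ℝ} (hq : 1 ≤ q) (hε : 0 < ε) : 2 ^ q ≤ slack q ε := by
  refine Real.rpow_le_rpow (by norm_num) ?_ (by linarith)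
  have h1 : 1 ≤ (1 + ε) / ε := by rw [le_div_iff₀ hε]; linarith
  have h2 : (1 : ℝ) ≤ 2 ^ q := Real.one_le_rpow (by norm_num) (by linarith)
  nlinarith

theorem one_le_two_rpow {q : ℝ} (hq : 1 ≤ q) : (1 : ℝ) ≤ 2 ^ q :=
  Real.one_le_rpow (by norm_num) (by linarith)

theorem resolution_pos {q ε : ℝ} (hq : 1 ≤ q) (hε : 0 < ε) : 0 < resolution q ε := by
  have := two_rpow_le_slack hq hε
  have := one_le_two_rpow hq
  unfold resolution
  have : 0 < slack q ε := by linarith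
  positivity

variable {T : Type*} [PseudoMetricSpace T]

/-- The `q`-th power of the distance. -/
noncomputable def powDist (q : ℝ) (u v : T) : ℝ := dist u v ^ q

theorem powDist_nonneg (q : ℝ) (u v : T) : 0 ≤ powDist q u v := by unfold powDist; positivity

theorem powDist_comm (q : ℝ) (u v : T) : powDist q u v = powDist q v u := by
  unfold powDist; rw [dist_comm]

theorem powDist_triangle {q t : ℝ} (ht : 0 < t) (hq : 0 ≤ q) (x y z : T) :
    powDist q x z ≤ (1 + t) ^ q * powDist q x y + (1 + 1 / t) ^ q * powDist q y z :=
  (Real.rpow_le_rpow dist_nonneg (dist_triangle x y z) hq).trans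
    (add_rpow_le_of_pos dist_nonneg dist_nonneg ht hq)

theorem powDist_triangle_two {q : ℝ} (hq : 0 ≤ q) (x y z : T) :
    powDist q x z ≤ 2 ^ q * powDist q x y + 2 ^ q * powDist q y z := by
  have := powDist_triangle one_pos hq x y z
  norm_num at this
  exact this

/-- The approximation guarantee for a clustering at resolution `resolution q ε`. -/
theorem cutWeight_powDist_le [Fintype T] [DecidableEq T] {q ε : ℝ} (hq : 1 ≤ q) (hε : 0 < ε)
    {κ : T → ℕ} {ρ : ℕ → T}
    (hρ : ∀ u, κ u ≠ 0 → resolution q ε * (Fintype.card T : ℝ) ^ 2 * powDist q u (ρ (κ u)) ≤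
      ∑ v : T, pointWeight (powDist q) v)
    (hfar : ∀ u, κ u = 0 → resolution q ε * ∑ v : T, pointWeight (powDist q) v ≤
      Fintype.card T * pointWeight (powDist q) u)
    {n : ℕ} (hn : 0 < n) {L L' : Finset T}
    (hL : #L = n) (hL' : #L' = n) (hR : #Lᶜ = n) (hR' : #L'ᶜ = n)
    (hκ : ∀ c, #{u ∈ L | κ u = c} = #{u ∈ L' | κ u = c}) :
    cutWeight (powDist q) L Lᶜ ≤ (1 + ε) * cutWeight (powDist q) L' L'ᶜ := by
  have hK := one_le_two_rpow hq
  have hX := resolution_pos hq hε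
  have hB := two_rpow_le_slack hq hε
  have hB0 : 0 < slack q ε := by linarith
  -- This makes (1+1/t)^q equal to `slack q ε` and 45η equal to ε/(1+ε), so 15η ≤ ε/3; the
  -- resolution makes the other error 0.66ε. The factor 1+ε keeps η and t at most 1 for large ε
  -- without a case distinction.
  set t : ℝ := ε / (45 * 2 ^ q * (1 + ε)) with ht
  set η : ℝ := 2 ^ q * t with hη
  have hηε : 45 * η = ε / (1 + ε) := by rw [hη, ht]; field_simp
  have hfrac : ε / (1 + ε) ≤ 1 := by rw [div_le_one (by linarith)]; linarith
  have hfrac' : ε / (1 + ε) ≤ ε := div_le_self hε.le (by linarith)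
  have ht0 : 0 < t := by positivity
  have hη0 : 0 < η := by positivity
  have ht1 : t ≤ 1 := by nlinarith
  have htri : ∀ x y z : T,
      powDist q x z ≤ (1 + η) * powDist q x y + slack q ε * powDist q y z := by
    intro x y z
    have h1 := powDist_triangle ht0 (by linarith : 0 ≤ q) x y z
    have h2 := mul_le_mul_of_nonneg_right (one_add_rpow_le ht0.le ht1 hq) (powDist_nonneg q x y)
    have h3 : (1 + 1 / t) ^ q = slack q ε := by
      unfold slack
      congr 2
      rw [ht]; field_simp
    rw [h3] at h1
    linarith
  have main := cutWeight_le_of_card_eq (powDist_nonneg q) (powDist_comm q) hη0.le (by linarith)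
    hK hB hX htri (powDist_triangle_two (by linarith)) hρ hfar hn hL hL' hR hR' hκ
  refine main.trans (mul_le_mul_of_nonneg_right ?_ (cutWeight_nonneg (powDist_nonneg q) _ _))
  have : 66 * (slack q ε * 2 ^ q) / resolution q ε = 66 / 100 * ε := by
    unfold resolution; field_simp
  rw [this]
  linarith

/-- In a doubling space, balls are covered by boundedly many small balls. -/
theorem DoublingDimLE.exists_cover {D : ℝ} (h : DoublingDimLE T D) {r : ℝ} (hr : 0 < r) (j : ℕ)
    (u : T) : ∃ C : Finset T, (#C : ℝ) ≤ ((2 : ℝ) ^ D) ^ j ∧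
      Metric.closedBall u (2 ^ j * r) ⊆ ⋃ v ∈ C, Metric.closedBall v r := by
  classical
  induction j generalizing u with
  | zero => exact ⟨{u}, by simp, by simp⟩
  | succ j ih =>
    obtain ⟨C, hC, hcov⟩ := h u (2 ^ (j + 1) * r) (by positivity)
    choose E hE hcovE using ih
    refine ⟨C.biUnion E, ?_, ?_⟩
    · calc (#(C.biUnion E) : ℝ) ≤ ∑ v ∈ C, (#(E v) : ℝ) := by exact_mod_cast card_biUnion_le
        _ ≤ ∑ v ∈ C, ((2 : ℝ) ^ D) ^ j := sum_le_sum fun v _ => hE v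
        _ = #C * ((2 : ℝ) ^ D) ^ j := by simp
        _ ≤ 2 ^ D * ((2 : ℝ) ^ D) ^ j := mul_le_mul_of_nonneg_right hC (by positivity)
        _ = _ := by ring
    · intro x hx
      have := hcov hx
      simp only [Set.mem_iUnion, exists_prop] at this
      obtain ⟨v, hv, hxv⟩ := this
      rw [show (2 : ℝ) ^ (j + 1) * r / 2 = 2 ^ j * r by ring] at hxv
      have := hcovE v hxv
      simp only [Set.mem_iUnion, exists_prop] at this
      obtain ⟨w, hw, hxw⟩ := this
      simp only [Set.mem_iUnion, exists_prop]
      exact ⟨w, mem_biUnion.2 ⟨v, hv, hw⟩, hxw⟩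

/-- A separated set of bounded diameter in a doubling space is small. -/
theorem DoublingDimLE.card_le {D : ℝ} (h : DoublingDimLE T D) {s : ℝ} (hs : 0 < s) (j : ℕ)
    {A : Finset T} (hd : ∀ x ∈ A, ∀ y ∈ A, dist x y ≤ 2 ^ j * s)
    (hsep : ∀ x ∈ A, ∀ y ∈ A, x ≠ y → s < dist x y) : (#A : ℝ) ≤ ((2 : ℝ) ^ D) ^ (j + 1) := by
  classical
  rcases A.eq_empty_or_nonempty with rfl | ⟨a, ha⟩
  · simp; positivity
  -- Balls of radius s/2 contain at most one point each of an s-separated set. The radius 2^j·s is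
  -- 2^(j+1) times s/2, hence the exponent `j + 1`.
  obtain ⟨C, hC, hcov⟩ := h.exists_cover (half_pos hs) (j + 1) a
  refine le_trans ?_ hC
  have key : ∀ x ∈ A, ∃ v ∈ C, dist x v ≤ s / 2 := by
    intro x hx
    have : x ∈ Metric.closedBall a (2 ^ (j + 1) * (s / 2)) := by
      rw [Metric.mem_closedBall]
      exact (hd x hx a ha).trans (le_of_eq (by ring))
    have := hcov this
    simpa only [Set.mem_iUnion, exists_prop, Metric.mem_closedBall] using this
  choose! g hg hgd using key
  have : #A ≤ #C := by
    refine card_le_card_of_injOn g hg fun x hx y hy hxy => ?_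
    by_contra hne
    have h1 := hsep x hx y hy hne
    have h2 := dist_triangle_right x y (g x)
    have h3 := hgd x hx
    have h4 := hgd y hy
    rw [← hxy] at h4
    linarith
  exact_mod_cast this

/-- A net of the near points has boundedly many elements. -/
theorem DoublingDimLE.card_net_le [Fintype T] {D : ℝ} (h : DoublingDimLE T D) {q X : ℝ}
    (hD : 0 ≤ D) (hq : 1 ≤ q) (hX : 0 < X) {j : ℕ} (hj : 2 * 2 ^ q * X ^ 2 ≤ 2 ^ j) {A : Finset T}
    (hnear : ∀ u ∈ A, Fintype.card T * pointWeight (powDist q) u ≤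
      X * ∑ v : T, pointWeight (powDist q) v)
    (hsep : ∀ u ∈ A, ∀ v ∈ A, u ≠ v →
      ∑ v : T, pointWeight (powDist q) v < X * (Fintype.card T : ℝ) ^ 2 * powDist q u v) :
    (#A : ℝ) ≤ ((2 : ℝ) ^ D) ^ (j + 1) := by
  have hq0 : 0 < q := by linarith
  have hone : (1 : ℝ) ≤ ((2 : ℝ) ^ D) ^ (j + 1) :=
    one_le_pow₀ (Real.one_le_rpow (by norm_num) hD)
  set S := ∑ v : T, pointWeight (powDist q) v with hS
  have hS0 : 0 ≤ S := sum_nonneg fun _ _ => pointWeight_nonneg (powDist_nonneg q) _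
  rcases A.eq_empty_or_nonempty with rfl | ⟨a, ha⟩
  · simp; positivity
  have hk : (0 : ℝ) < Fintype.card T := by
    have : Nonempty T := ⟨a⟩
    exact_mod_cast Fintype.card_pos
  -- If S = 0, all distances vanish and no two distinct points of `A` can be separated; the scale
  -- `s` below would be 0.
  rcases hS0.eq_or_lt with h0 | hSpos
  · have hw : ∀ u : T, pointWeight (powDist q) u = 0 := fun u =>
      (sum_eq_zero_iff_of_nonneg fun u _ => pointWeight_nonneg (powDist_nonneg q) u).1
        (hS.symm.trans h0.symm) u (mem_univ _)
    have hf : ∀ u v : T, powDist q u v = 0 := fun u v =>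
      (sum_eq_zero_iff_of_nonneg fun v _ => powDist_nonneg q u v).1 (hw u) v (mem_univ _)
    have : #A ≤ 1 := card_le_one.2 fun u hu v hv => by
      by_contra hne
      have := hsep u hu v hv hne
      rw [hf, ← h0] at this
      simp at this
    exact le_trans (by exact_mod_cast this) hone
  -- The distance whose q-th power is the threshold of closeness.
  set s : ℝ := (S / (X * (Fintype.card T : ℝ) ^ 2)) ^ (1 / q) with hs
  have hs0 : 0 < s := by positivity
  have hsq : s ^ q = S / (X * (Fintype.card T : ℝ) ^ 2) := by
    rw [hs, ← Real.rpow_mul (by positivity), one_div_mul_cancel hq0.ne', Real.rpow_one]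
  refine h.card_le hs0 j ?_ ?_
  · intro x hx y hy
    rw [← Real.rpow_le_rpow_iff dist_nonneg (by positivity) hq0,
      Real.mul_rpow (by positivity) hs0.le, hsq]
    have h1 := card_mul_le (powDist_comm q) (powDist_triangle_two hq0.le) x y
    have h2 := hnear x hx
    have h3 := hnear y hy
    have hK := one_le_two_rpow hq
    have h4 : (Fintype.card T : ℝ) ^ 2 * powDist q x y ≤ 2 * 2 ^ q * (X * S) := by
      have := mul_le_mul_of_nonneg_left h1 hk.le
      nlinarith
    have h5 : dist x y ^ q ≤ 2 * 2 ^ q * X ^ 2 * (S / (X * (Fintype.card T : ℝ) ^ 2)) := by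
      have : 2 * 2 ^ q * X ^ 2 * (S / (X * (Fintype.card T : ℝ) ^ 2)) =
          2 * 2 ^ q * (X * S) / (Fintype.card T : ℝ) ^ 2 := by field_simp
      rw [this, le_div_iff₀ (by positivity), mul_comm]
      exact h4
    refine h5.trans (mul_le_mul_of_nonneg_right (hj.trans ?_) (by positivity))
    -- The hypothesis on `j` bounds a ratio of q-th powers by 2^j, and 2^j ≤ (2^j)^q because q ≥ 1.
    exact Real.self_le_rpow_of_one_le (one_le_pow₀ (by norm_num)) hq
  · intro x hx y hy hne
    rw [← Real.rpow_lt_rpow_iff hs0.le dist_nonneg hq0, hsq, div_lt_iff₀ (by positivity), mul_comm]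
    exact hsep x hx y hy hne

end Metric

/-! ### The program and its verification -/

namespace RealRAM

open Finset

/-- The scalar stored in cell `0` of integer array `x`. -/
abbrev NExp.var (x : ℕ) : NExp := .get x (.lit 0)

/-- The scalar stored in cell `0` of real array `x`. -/
abbrev RExp.var (x : ℕ) : RExp := .get x (.lit 0)

/-- The weight of the pair `i`, `j`. -/
noncomputable def Input.pairWeight (I : Input) (i j : ℕ) : ℝ := |I.dist i j| ^ I.q

/-- The total weight at the point `i`. -/
noncomputable def Input.weight (I : Input) (i : ℕ) : ℝ := ∑ j ∈ range I.size, I.pairWeight i j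

/-- The total weight. -/
noncomputable def Input.total (I : Input) : ℝ := ∑ i ∈ range I.size, I.weight i

/-- The weight of the pairs that are separated by `P`. -/
noncomputable def Input.cut (I : Input) (P : ℕ → Prop) [DecidablePred P] : ℝ :=
  ∑ i ∈ range I.size, ∑ j ∈ range I.size, if P i ∧ ¬ P j then I.pairWeight i j else 0

theorem Input.pairWeight_nonneg (I : Input) (i j : ℕ) : 0 ≤ I.pairWeight i j :=
  Real.rpow_nonneg (abs_nonneg _) _

theorem Input.total_nonneg (I : Input) : 0 ≤ I.total :=
  sum_nonneg fun _ _ => sum_nonneg fun _ _ => I.pairWeight_nonneg _ _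

/-- This lets the total weight serve as the initial record of the search, in place of infinity. -/
theorem Input.cut_le_total (I : Input) (P : ℕ → Prop) [DecidablePred P] : I.cut P ≤ I.total := by
  refine sum_le_sum fun i _ => sum_le_sum fun j _ => ?_
  split_ifs
  · exact le_rfl
  · exact I.pairWeight_nonneg i j

theorem Input.cut_congr (I : Input) {P P' : ℕ → Prop} [DecidablePred P] [DecidablePred P']
    (h : ∀ i < I.size, P i ↔ P' i) : I.cut P = I.cut P' := by
  refine sum_congr rfl fun i hi => sum_congr rfl fun j hj => ?_
  simp only [h i (mem_range.1 hi), h j (mem_range.1 hj)]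

/-! ### Weights -/

/-- Compute `weight i` in cell `i` of real array `1` and `total` in real array `0`. -/
def weightProg : Prog :=
  forLoop 1 .size (.seq
    (forLoop 2 .size (.setReal 1 (.var 1)
      (.add (.get 1 (.var 1)) (.pow (.dist (.var 1) (.var 2))))))
    (.setReal 0 (.lit 0) (.add (.var 0) (.get 1 (.var 1)))))

/-- Memory layout of the whole program. Integer arrays: 0 output, 1 and 2 counters, 3 cluster of a
point, 4 centers, 5 number of clusters, 6 cluster sizes, 7 ranks, 8 digits, 9 carry, 10 number of
selected points. Real arrays: 0 total weight, 1 weights of the points, 2 resolution, 3 current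
value, 4 best value. -/
theorem ends_weightProg_inner (I : Input) (m : Memory) (i : ℕ) (hi : m.nat 1 0 = i)
    (h0 : m.real 1 i = 0) :
    Ends I (forLoop 2 .size (.setReal 1 (.var 1)
      (.add (.get 1 (.var 1)) (.pow (.dist (.var 1) (.var 2)))))) m (I.size * 30 + 30)
      fun m' => Frame [2] [1] m m' ∧ (∀ u, u ≠ i → m'.real 1 u = m.real 1 u) ∧
        m'.real 1 i = I.weight i := by
  refine Ends.le (Ends.forLoop (N := I.size) (T := 14) (fun j m' => Frame [2] [1] m m' ∧
    (∀ u, u ≠ i → m'.real 1 u = m.real 1 u) ∧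
    m'.real 1 i = ∑ v ∈ range j, I.pairWeight i v) ?_ ?_ ?_ ?_ ?_) ?le
  · intros; rfl
  · rintro j m' a ⟨h1, h2, h3⟩
    exact ⟨h1.setNat (by simp) _ _, h2, h3⟩
  · rintro j hj m' ⟨h1, h2, h3⟩ hv
    have hi' : m'.nat 1 0 = i := (h1.1 1 (by simp) 0).trans hi
    refine Ends.le (Ends.setReal ⟨hv, h1.setReal (by simp) _ _, ?_, ?_⟩)
      (by simp [NExp.cost, RExp.cost])
    · intro u hu
      simp [NExp.eval, hi', hu, h2 u hu]
    · simp [NExp.eval, RExp.eval, hi', hv, h3, sum_range_succ, Input.pairWeight]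
  · exact ⟨Frame.refl _ _ _, fun _ _ => rfl, by simp [h0]⟩
  · exact fun m' h => h
  case le => simp [NExp.cost]; omega

theorem ends_weightProg (I : Input) (m : Memory) (h1 : ∀ i, m.real 1 i = 0)
    (h0 : m.real 0 0 = 0) :
    Ends I weightProg m (I.size * (I.size * 30 + 60) + 20) fun m' => Frame [1, 2] [0, 1] m m' ∧
      (∀ i < I.size, m'.real 1 i = I.weight i) ∧ m'.real 0 0 = I.total := by
  refine Ends.le (Ends.forLoop (N := I.size) (T := I.size * 30 + 40) (fun i m' =>
    Frame [1, 2] [0, 1] m m' ∧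
    (∀ u < i, m'.real 1 u = I.weight u) ∧ (∀ u, i ≤ u → m'.real 1 u = 0) ∧
    m'.real 0 0 = ∑ u ∈ range i, I.weight u) ?_ ?_ ?_ ?_ ?_) ?le
  · intros; rfl
  · rintro i m' a ⟨h1, h2, h3, h4⟩
    exact ⟨h1.setNat (by simp) _ _, h2, h3, h4⟩
  · rintro i hi m' ⟨h1, h2, h3, h4⟩ hv
    refine Ends.seq (T' := 10) ((ends_weightProg_inner I m' i hv (h3 i le_rfl)).mono le_rfl ?_)
    rintro m₁ ⟨g1, g2, g3⟩
    have hv1 : m₁.nat 1 0 = i := (g1.1 1 (by simp) 0).trans hv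
    refine Ends.le (Ends.setReal ⟨hv1, (h1.trans g1 (by simp) (by simp)).setReal (by simp) _ _,
      ?_, ?_, ?_⟩) (by simp [NExp.cost, RExp.cost])
    · intro u hu
      rcases (Nat.lt_succ_iff_lt_or_eq.1 hu) with h | rfl
      · simp [g2 u h.ne, h2 u h]
      · simp [g3]
    · intro u hu
      simp [g2 u (by omega), h3 u (by omega)]
    · simp [NExp.eval, RExp.eval, hv1, g3, g1.2 0 (by simp), h4, sum_range_succ]
  · exact ⟨Frame.refl _ _ _, by simp, fun u _ => h1 u, by simp [h0]⟩
  · exact fun m' h => ⟨h.1, h.2.1, h.2.2.2⟩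
  case le =>
    simp only [NExp.cost]
    rw [add_assoc]
    exact Nat.add_le_add (Nat.mul_le_mul_left _ (by omega)) (by norm_num)

/-! ### Clusters -/

/-- The first `i` points are divided into `M` clusters: `cl` is the cluster, `cen` the center of a
cluster, `sz` the size of a cluster, and `rk` the rank of a point within its cluster. Cluster `0`
consists of the points that are not near, and the other centers are pairwise not close. -/
structure Clustering (near : ℕ → Prop) (close : ℕ → ℕ → Prop) (i M : ℕ) (cl cen sz rk : ℕ → ℕ) :
    Prop where
  pos : 1 ≤ M
  le : M ≤ i + 1
  lt : ∀ u < i, cl u < M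
  near_iff : ∀ u < i, cl u = 0 ↔ ¬ near u
  close_cen : ∀ u < i, near u → close u (cen (cl u))
  cen_near : ∀ j, 1 ≤ j → j < M → cen j < i ∧ near (cen j)
  sep : ∀ j j', 1 ≤ j → j < j' → j' < M → ¬ close (cen j') (cen j)
  sz_eq : ∀ c, sz c = #{v ∈ range i | cl v = c}
  rk_eq : ∀ u < i, rk u = #{v ∈ range u | cl v = cl u}

/-- One greedy step for the point `i`: its cluster `j` is 0 if `i` is not near, otherwise an old
cluster with a close center or the new cluster `M` centered at `i`. The rank of `i` is the size of
its cluster before insertion. -/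
theorem Clustering.step {near : ℕ → Prop} {close : ℕ → ℕ → Prop} {i M M' j : ℕ}
    {cl cen sz rk cl' cen' sz' rk' : ℕ → ℕ} (h : Clustering near close i M cl cen sz rk)
    (hj : j < M') (hM : M ≤ M') (hM' : M' ≤ M + 1) (hjn : j = 0 ↔ ¬ near i)
    (hclose : near i → close i (cen' j)) (hcen : ∀ c < M, cen' c = cen c)
    (hnew : M < M' → cen' M = i ∧ near i ∧ ∀ c, 1 ≤ c → c < M → ¬ close i (cen c))
    (hcl : ∀ u, cl' u = if u = i then j else cl u)
    (hsz : ∀ c, sz' c = if c = j then sz j + 1 else sz c)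
    (hrk : ∀ u, rk' u = if u = i then sz j else rk u) :
    Clustering near close (i + 1) M' cl' cen' sz' rk' := by
  have e : ∀ u < i, cl' u = cl u := fun u hu => by rw [hcl, if_neg hu.ne]
  have ei : cl' i = j := by rw [hcl, if_pos rfl]
  have cnt : ∀ u ≤ i, ∀ c, #{v ∈ range u | cl' v = c} = #{v ∈ range u | cl v = c} := by
    intro u hu c
    congr 1
    exact filter_congr fun v hv => by rw [e v (by have := mem_range.1 hv; omega)]
  refine ⟨h.pos.trans hM, hM'.trans (by have := h.le; omega), ?_, ?_, ?_, ?_, ?_, ?_, ?_⟩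
  · intro u hu
    rcases Nat.lt_succ_iff_lt_or_eq.1 hu with hu | rfl
    · rw [e u hu]; exact (h.lt u hu).trans_le hM
    · rwa [ei]
  · intro u hu
    rcases Nat.lt_succ_iff_lt_or_eq.1 hu with hu | rfl
    · rw [e u hu]; exact h.near_iff u hu
    · rwa [ei]
  · intro u hu hn
    rcases Nat.lt_succ_iff_lt_or_eq.1 hu with hu | rfl
    · rw [e u hu, hcen _ (h.lt u hu)]; exact h.close_cen u hu hn
    · rw [ei]; exact hclose hn
  · intro c hc hc'
    by_cases hcM : c < M
    · rw [hcen c hcM]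
      exact ⟨(h.cen_near c hc hcM).1.trans (Nat.lt_succ_self _), (h.cen_near c hc hcM).2⟩
    · obtain rfl : c = M := by omega
      obtain ⟨h1, h2, -⟩ := hnew hc'
      rw [h1]; exact ⟨Nat.lt_succ_self _, h2⟩
  · intro c c' hc hcc' hc'
    by_cases hcM : c' < M
    · rw [hcen c (hcc'.trans hcM), hcen c' hcM]; exact h.sep c c' hc hcc' hcM
    · obtain rfl : c' = M := by omega
      obtain ⟨h1, -, h3⟩ := hnew hc'
      rw [h1, hcen c hcc']; exact h3 c hc hcc'
  · intro c
    rw [range_add_one, filter_insert, ei, hsz]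
    by_cases hc : c = j
    · subst hc
      rw [if_pos rfl, if_pos rfl, card_insert_of_notMem (by simp), cnt i le_rfl, h.sz_eq]
    · rw [if_neg hc, if_neg (Ne.symm hc), cnt i le_rfl, h.sz_eq]
  · intro u hu
    rcases Nat.lt_succ_iff_lt_or_eq.1 hu with hu | rfl
    · rw [e u hu, hrk, if_neg hu.ne, cnt u hu.le, h.rk_eq u hu]
    · rw [ei, hrk, if_pos rfl, cnt u le_rfl, h.sz_eq]

/-- The point `u` is near at resolution `X`. -/
def Input.Near (I : Input) (X : ℝ) (u : ℕ) : Prop := I.size * I.weight u ≤ X * I.total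

/-- The points `u` and `v` are close at resolution `X`. -/
def Input.Close (I : Input) (X : ℝ) (u v : ℕ) : Prop :=
  X * (I.size * I.size) * I.pairWeight u v ≤ I.total

/-- The test whether the points with indices `u` and `v` are close. -/
def closeTest (u v : NExp) : Test :=
  .realLe (.mul (.mul (.var 2) (.mul (.ofNat .size) (.ofNat .size))) (.pow (.dist u v))) (.var 0)

/-- Look for a center close to the current point. -/
def scanProg : Prog :=
  .loop (.and (.natLe (.add (.var 2) (.lit 1)) (.var 5))
      (.not (closeTest (.var 1) (.get 4 (.var 2)))))
    (.setNat 2 (.lit 0) (.add (.var 2) (.lit 1)))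

/-- Assign the current point to a cluster. -/
def assignProg : Prog :=
  .branch (.realLe (.mul (.ofNat .size) (.get 1 (.var 1))) (.mul (.var 2) (.var 0)))
    (.seq (.setNat 2 (.lit 0) (.lit 1)) (.seq scanProg (.seq (.setNat 3 (.var 1) (.var 2))
      (.branch (.natLe (.var 5) (.var 2))
        (.seq (.setNat 4 (.var 5) (.var 1)) (.setNat 5 (.lit 0) (.add (.var 5) (.lit 1))))
        .skip))))
    (.setNat 3 (.var 1) (.lit 0))

/-- Divide the points into clusters. -/
def clusterProg : Prog :=
  .seq (.setNat 5 (.lit 0) (.lit 1))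
    (forLoop 1 .size (.seq assignProg (.seq
      (.setNat 7 (.var 1) (.get 6 (.get 3 (.var 1))))
      (.setNat 6 (.get 3 (.var 1)) (.add (.get 6 (.get 3 (.var 1))) (.lit 1))))))

/-- The search starts at 1, as cluster 0 has no center. An unsuccessful search stops at `M`, which
is exactly the number of the cluster to be opened. -/
theorem ends_scanProg (I : Input) {X : ℝ} (m : Memory) {i M : ℕ} (hi : m.nat 1 0 = i)
    (hX : m.real 2 0 = X) (hS : m.real 0 0 = I.total) (hM : m.nat 5 0 = M) (hM1 : 1 ≤ M)
    (h2 : m.nat 2 0 = 1) :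
    Ends I scanProg m (M * 40 + 40) fun m' => Frame [2] [] m m' ∧
      1 ≤ m'.nat 2 0 ∧ m'.nat 2 0 ≤ M ∧
      (∀ c, 1 ≤ c → c < m'.nat 2 0 → ¬ I.Close X i (m.nat 4 c)) ∧
      (m'.nat 2 0 < M → I.Close X i (m.nat 4 (m'.nat 2 0))) := by
  have hb : ∀ m' : Memory, Frame [2] [] m m' →
      ((closeTest (.var 1) (.get 4 (.var 2))).Holds I m' ↔ I.Close X i (m.nat 4 (m'.nat 2 0))) := by
    intro m' h
    simp only [closeTest, Test.Holds, RExp.eval, NExp.eval, h.2 2 (by simp), h.2 0 (by simp), hX, hS,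
      h.1 1 (by simp), h.1 4 (by simp), hi, Input.Close, Input.pairWeight]
  refine Ends.le (Ends.loop (N := M) (T := 7) (fun j m' => Frame [2] [] m m' ∧
    j = m'.nat 2 0 ∧ 1 ≤ j ∧ j ≤ M ∧
      (∀ c, 1 ≤ c → c < m'.nat 2 0 → ¬ I.Close X i (m.nat 4 c))) (i := 1) ?_ ?_ ?_) ?le
  · rintro j m' ⟨h1, rfl, h3, h4, h5⟩ hh
    have hlt : m'.nat 2 0 < M := by
      have := hh.1
      simp only [Test.Holds, NExp.eval, h1.1 5 (by simp), hM] at this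
      omega
    have hc : ¬ I.Close X i (m.nat 4 (m'.nat 2 0)) := fun e => hh.2 ((hb m' h1).2 e)
    refine ⟨hlt, Ends.le (Ends.setNat ⟨h1.setNat (by simp) _ _, ?_, by omega, by omega, ?_⟩) ?_⟩
    · simp [NExp.eval]
    · intro c hc1 hc2
      simp only [NExp.eval, Memory.setNat_nat, and_self, if_true] at hc2
      rcases Nat.lt_succ_iff_lt_or_eq.1 hc2 with h | rfl
      · exact h5 c hc1 h
      · exact hc
    · simp [NExp.cost]
  · exact ⟨Frame.refl _ _ _, h2.symm, le_rfl, hM1, by rw [h2]; intros; omega⟩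
  · rintro j m' ⟨h1, rfl, h3, h4, h5⟩ hh
    refine ⟨h1, h3, h4, h5, fun hlt => ?_⟩
    by_contra hc
    refine hh ⟨?_, fun e => hc ((hb m' h1).1 e)⟩
    simp only [Test.Holds, NExp.eval, h1.1 5 (by simp), hM]
    exact hlt
  case le =>
    simp only [closeTest, Test.cost, NExp.cost, RExp.cost]
    omega

/-- The hypothesis `hrefl` is needed when `i` becomes a center, which must be close to itself. -/
theorem ends_assignProg (I : Input) {X : ℝ} (m : Memory) {i M : ℕ} (hi : m.nat 1 0 = i)
    (hX : m.real 2 0 = X) (hS : m.real 0 0 = I.total) (hw : m.real 1 i = I.weight i)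
    (hM : m.nat 5 0 = M) (hM1 : 1 ≤ M) (hrefl : I.Close X i i) :
    Ends I assignProg m (M * 40 + 100) fun m' => Frame [2, 3, 4, 5] [] m m' ∧
      ∃ j, j < m'.nat 5 0 ∧ M ≤ m'.nat 5 0 ∧ m'.nat 5 0 ≤ M + 1 ∧ (j = 0 ↔ ¬ I.Near X i) ∧
        (I.Near X i → I.Close X i (m'.nat 4 j)) ∧ (∀ c < M, m'.nat 4 c = m.nat 4 c) ∧
        (M < m'.nat 5 0 → m'.nat 4 M = i ∧ I.Near X i ∧
          ∀ c, 1 ≤ c → c < M → ¬ I.Close X i (m.nat 4 c)) ∧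
        (∀ u, m'.nat 3 u = if u = i then j else m.nat 3 u) := by
  have hb : (Test.realLe (.mul (.ofNat .size) (.get 1 (.var 1))) (.mul (.var 2) (.var 0))).Holds I m
      ↔ I.Near X i := by
    simp only [Test.Holds, RExp.eval, NExp.eval, hi, hX, hS, hw, Input.Near]
  refine Ends.le (Ends.branch (fun h => Ends.seq (Ends.setNat (Ends.seq (T' := 30)
    ((ends_scanProg I (X := X) _ (i := i) (M := M) ?_ ?_ ?_ ?_ hM1 ?_).mono le_rfl ?_))))
    fun h => Ends.setNat ?_) ?le
  · simpa using hi
  · simpa using hX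
  · simpa using hS
  · simpa using hM
  · simp [NExp.eval]
  · rintro m₁ ⟨h1, h2, h3, h4, h5⟩
    have f1 : Frame [2, 3, 4, 5] [] m m₁ :=
      ((Frame.refl _ _ m).setNat (by simp) _ _).trans h1 (by simp) (by simp)
    have g1 : m₁.nat 1 0 = i := (f1.1 1 (by simp) 0).trans hi
    have g5 : m₁.nat 5 0 = M := by rw [h1.1 5 (by simp)]; simpa using hM
    have g4 : ∀ c, m₁.nat 4 c = m.nat 4 c := fun c => by rw [h1.1 4 (by simp)]; simp
    have g3 : ∀ c, m₁.nat 3 c = m.nat 3 c := fun c => by rw [h1.1 3 (by simp)]; simp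
    have k4 : ∀ c, (m.setNat 2 ((NExp.lit 0).eval I m) ((NExp.lit 1).eval I m)).nat 4 c =
        m.nat 4 c := by simp
    simp only [k4] at h4 h5
    refine Ends.le (Ends.seq (Ends.setNat (Ends.branch (fun hh => Ends.seq (Ends.setNat
      (Ends.setNat ?_))) fun hh => Ends.skip ?_))) (by simp [NExp.cost, Test.cost])
    · simp [Test.Holds, NExp.eval, g5] at hh
      have hjM : m₁.nat 2 0 = M := le_antisymm h3 hh
      refine ⟨((f1.setNat (by simp) _ _).setNat (by simp) _ _).setNat (by simp) _ _, M, ?_⟩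
      simp only [NExp.eval, Memory.setNat_nat, g1, g5, hjM]
      simp
      refine ⟨⟨fun e => absurd e (by omega), fun e => absurd (hb.1 h) e⟩, fun _ => hrefl, ?_,
        ⟨hb.1 h, fun c hc1 hc2 => h4 c hc1 (by omega)⟩, ?_⟩
      · intro c hc
        rw [if_neg hc.ne, g4]
      · intro u
        rw [g3]
    · simp [Test.Holds, NExp.eval, g5] at hh
      refine ⟨f1.setNat (by simp) _ _, m₁.nat 2 0, ?_⟩
      simp only [NExp.eval, Memory.setNat_nat, g1, g5]
      simp [g4, g3]
      exact ⟨hh, ⟨fun e => absurd e (by omega), fun e => absurd (hb.1 h) e⟩, fun _ => h5 hh⟩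
  · refine ⟨(Frame.refl _ _ m).setNat (by simp) _ _, 0, ?_⟩
    have hn : ¬ I.Near X i := fun e => h (hb.2 e)
    simp only [NExp.eval, Memory.setNat_nat, hi]
    simp [hM, hn]
    omega
  case le =>
    simp only [Test.cost, NExp.cost, RExp.cost]
    omega

theorem ends_clusterProg (I : Input) {X : ℝ} (m : Memory)
    (hX : m.real 2 0 = X) (hS : m.real 0 0 = I.total) (hw : ∀ i < I.size, m.real 1 i = I.weight i)
    (hsz : ∀ c, m.nat 6 c = 0) (hrefl : ∀ i < I.size, I.Close X i i) :
    Ends I clusterProg m (I.size * (I.size * 40 + 200) + 50) fun m' =>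
      Frame [1, 2, 3, 4, 5, 6, 7] [] m m' ∧
      Clustering (I.Near X) (I.Close X) I.size (m'.nat 5 0) (m'.nat 3) (m'.nat 4) (m'.nat 6)
        (m'.nat 7) := by
  refine Ends.le (Ends.seq (Ends.setNat (Ends.forLoop (N := I.size) (T := I.size * 40 + 180)
    (fun i m' => Frame [1, 2, 3, 4, 5, 6, 7] [] m m' ∧
      Clustering (I.Near X) (I.Close X) i (m'.nat 5 0) (m'.nat 3) (m'.nat 4) (m'.nat 6)
        (m'.nat 7)) ?_ ?_ ?_ ?_ ?_))) ?le
  · intros; rfl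
  · rintro i m' a ⟨h1, h2⟩
    refine ⟨h1.setNat (by simp) _ _, ?_⟩
    convert h2 using 1 <;> first | (ext; simp) | simp
  · rintro i hi m' ⟨h1, h2⟩ hv
    refine Ends.le (Ends.seq (T' := 30) ((ends_assignProg I (X := X) m' hv ?_ ?_ ?_ rfl h2.pos
      (hrefl i hi)).mono le_rfl ?_)) ?le'
    · rw [h1.2 2 (by simp), hX]
    · rw [h1.2 0 (by simp), hS]
    · rw [h1.2 1 (by simp), hw i hi]
    · rintro m₁ ⟨f1, j, g1, g2, g3, g4, g5, g6, g7, g8⟩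
      have hv1 : m₁.nat 1 0 = i := (f1.1 1 (by simp) 0).trans hv
      have k6 : ∀ c, m₁.nat 6 c = m'.nat 6 c := f1.1 6 (by simp)
      have k7 : ∀ c, m₁.nat 7 c = m'.nat 7 c := f1.1 7 (by simp)
      have hci : m₁.nat 3 i = j := by rw [g8, if_pos rfl]
      refine Ends.le (Ends.seq (Ends.setNat (Ends.setNat ⟨?_, ((h1.trans f1 (by simp)
        (by simp)).setNat (by simp) _ _).setNat (by simp) _ _, ?_⟩))) (by simp [NExp.cost])
      · simp [hv1]
      · refine h2.step (j := j) ?_ ?_ ?_ g4 ?_ ?_ ?_ ?_ ?_ ?_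
        · simpa using g1
        · simpa using g2
        · simpa using g3
        · simpa using g5
        · simpa using g6
        · simpa using g7
        · simpa using g8
        · intro c
          simp [NExp.eval, hv1, hci, k6]
        · intro c
          simp [NExp.eval, hv1, hci, k6, k7]
    case le' =>
      -- At most `i + 1` clusters exist so far, so the scan is linear in the number of points
      -- without any use of doubling.
      have := h2.le
      omega
  · refine ⟨(Frame.refl _ _ _).setNat (by simp) _ _, ?_⟩
    constructor <;> (try simp [NExp.eval, hsz]) <;> intros <;> omega
  · exact fun m' h => h
  case le =>
    simp only [NExp.cost]
    have : I.size * (I.size * 40 + 180 + 1 + 12) ≤ I.size * (I.size * 40 + 200) :=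
      Nat.mul_le_mul_left _ (by omega)
    omega

/-! ### Enumeration of the bipartitions -/

/-- The rank of the point `u` within its cluster is less than the digit of the cluster. -/
abbrev Memory.Selects (m : Memory) (u : ℕ) : Prop := m.nat 7 u < m.nat 8 (m.nat 3 u)

/-- The test for `Memory.Selects`, for the point with index stored in integer array `v`. -/
def selectTest (v : ℕ) : Test := .natLe (.add (.get 7 (.var v)) (.lit 1)) (.get 8 (.get 3 (.var v)))

theorem selectTest_holds {I : Input} {m m' : Memory} {ns rs : List ℕ} (h : Frame ns rs m m')
    (h3 : 3 ∉ ns) (h7 : 7 ∉ ns) (h8 : 8 ∉ ns) {v i : ℕ} (hv : m'.nat v 0 = i) :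
    (selectTest v).Holds I m' ↔ m.Selects i := by
  simp only [selectTest, Test.Holds, NExp.eval, hv, h.1 3 h3, h.1 7 h7, h.1 8 h8, Memory.Selects,
    Nat.succ_le_iff]

/-- Count the selected points. -/
def countProg : Prog :=
  .seq (.setNat 10 (.lit 0) (.lit 0)) (forLoop 1 .size (.branch (selectTest 1)
    (.setNat 10 (.lit 0) (.add (.var 10) (.lit 1))) .skip))

theorem ends_countProg (I : Input) (m : Memory) :
    Ends I countProg m (I.size * 50 + 50) fun m' => Frame [1, 10] [] m m' ∧
      m'.nat 10 0 = #{u ∈ range I.size | m.Selects u} := by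
  refine Ends.le (Ends.seq (Ends.setNat (Ends.forLoop (N := I.size) (T := 30) (fun i m' =>
    Frame [1, 10] [] m m' ∧ m'.nat 10 0 = #{u ∈ range i | m.Selects u}) ?_ ?_ ?_ ?_ ?_))) ?le
  · intros; rfl
  · rintro i m' a ⟨h1, h2⟩
    exact ⟨h1.setNat (by simp) _ _, by simpa using h2⟩
  · rintro i hi m' ⟨h1, h2⟩ hv
    have hb := selectTest_holds (I := I) h1 (by simp) (by simp) (by simp) hv
    refine Ends.le (Ends.branch (fun h => Ends.setNat ⟨?_, h1.setNat (by simp) _ _, ?_⟩)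
      fun h => Ends.skip ⟨hv, h1, ?_⟩) (by simp [selectTest, Test.cost, NExp.cost])
    · simpa using hv
    · rw [range_add_one, filter_insert, if_pos (hb.1 h), card_insert_of_notMem (by simp)]
      simp [NExp.eval, h2]
    · rw [range_add_one, filter_insert, if_neg (fun e => h (hb.2 e)), h2]
  · exact ⟨(Frame.refl _ _ _).setNat (by simp) _ _, by simp [NExp.eval]⟩
  · exact fun m' h => h
  case le => simp only [NExp.cost]; omega

/-- Compute the value of the selected bipartition. -/
def cutProg : Prog :=
  .seq (.setReal 3 (.lit 0) (.ofNat (.lit 0))) (forLoop 1 .size (forLoop 2 .size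
    (.branch (.and (selectTest 1) (.not (selectTest 2)))
      (.setReal 3 (.lit 0) (.add (.var 3) (.pow (.dist (.var 1) (.var 2))))) .skip)))

theorem ends_cutProg (I : Input) (m : Memory) :
    Ends I cutProg m (I.size * (I.size * 70 + 50) + 50) fun m' => Frame [1, 2] [3] m m' ∧
      m'.real 3 0 = I.cut m.Selects := by
  refine Ends.le (Ends.seq (Ends.setReal (Ends.forLoop (N := I.size) (T := I.size * 70 + 30)
    (fun i m' => Frame [1, 2] [3] m m' ∧ m'.real 3 0 = ∑ u ∈ range i, ∑ v ∈ range I.size,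
      if m.Selects u ∧ ¬ m.Selects v then I.pairWeight u v else 0) ?_ ?_ ?_ ?_ ?_))) ?le
  · intros; rfl
  · rintro i m' a ⟨h1, h2⟩
    exact ⟨h1.setNat (by simp) _ _, h2⟩
  · rintro i hi m₁ ⟨g1, g2⟩ hv
    refine Ends.le (Ends.forLoop (N := I.size) (T := 50)
      (fun j m' => Frame [1, 2] [3] m m' ∧ m'.nat 1 0 = i ∧ m'.real 3 0 = (∑ u ∈ range i,
        ∑ v ∈ range I.size, if m.Selects u ∧ ¬ m.Selects v then I.pairWeight u v else 0) +
        ∑ v ∈ range j, if m.Selects i ∧ ¬ m.Selects v then I.pairWeight i v else 0)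
      ?_ ?_ ?_ ?_ ?_) ?le'
    · intros; rfl
    · rintro i m' a ⟨h1, h2, h3⟩
      exact ⟨h1.setNat (by simp) _ _, by simpa using h2, h3⟩
    · rintro j hj m' ⟨h1, h2, h3⟩ hv'
      have hb : (Test.and (selectTest 1) (.not (selectTest 2))).Holds I m' ↔
          (m.Selects i ∧ ¬ m.Selects j) := and_congr
        (selectTest_holds h1 (by simp) (by simp) (by simp) h2)
        (not_congr (selectTest_holds h1 (by simp) (by simp) (by simp) hv'))
      refine Ends.le (Ends.branch (fun h => Ends.setReal ⟨hv', h1.setReal (by simp) _ _, h2, ?_⟩)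
        fun h => Ends.skip ⟨hv', h1, h2, ?_⟩)
        (by simp [selectTest, Test.cost, NExp.cost, RExp.cost])
      · rw [sum_range_succ, if_pos (hb.1 h)]
        simp [NExp.eval, RExp.eval, h2, h3, hv', Input.pairWeight, add_assoc]
      · rw [sum_range_succ, if_neg (fun e => h (hb.2 e)), h3, add_zero]
    · exact ⟨g1, hv, by simp [g2]⟩
    · rintro m' ⟨h1, h2, h3⟩
      exact ⟨h2, h1, by rw [sum_range_succ, h3]⟩
    case le' => simp only [NExp.cost]; omega
  · exact ⟨(Frame.refl _ _ _).setReal (by simp) _ _, by simp [RExp.eval, NExp.eval]⟩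
  · exact fun m' h => h
  case le =>
    simp only [NExp.cost, RExp.cost]
    have : I.size * (I.size * 70 + 30 + 1 + 12) ≤ I.size * (I.size * 70 + 50) :=
      Nat.mul_le_mul_left _ (by omega)
    omega

/-- Copy the selected set to the output. -/
def copyProg : Prog :=
  forLoop 1 .size (.branch (selectTest 1) (.setNat 0 (.var 1) (.lit 1))
    (.setNat 0 (.var 1) (.lit 0)))

theorem ends_copyProg (I : Input) (m : Memory) :
    Ends I copyProg m (I.size * 50 + 20) fun m' => Frame [0, 1] [] m m' ∧
      ∀ u < I.size, m'.nat 0 u = 1 ↔ m.Selects u := by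
  refine Ends.le (Ends.forLoop (N := I.size) (T := 30) (fun i m' =>
    Frame [0, 1] [] m m' ∧ ∀ u < i, m'.nat 0 u = 1 ↔ m.Selects u) ?_ ?_ ?_ ?_ ?_) ?le
  · intros; rfl
  · rintro i m' a ⟨h1, h2⟩
    exact ⟨h1.setNat (by simp) _ _, by simpa using h2⟩
  · rintro i hi m' ⟨h1, h2⟩ hv
    have hb := selectTest_holds (I := I) h1 (by simp) (by simp) (by simp) hv
    refine Ends.le (Ends.branch (fun h => Ends.setNat ⟨?_, h1.setNat (by simp) _ _, ?_⟩)
      fun h => Ends.setNat ⟨?_, h1.setNat (by simp) _ _, ?_⟩)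
      (by simp [selectTest, Test.cost, NExp.cost])
    · simpa using hv
    · intro u hu
      rcases Nat.lt_succ_iff_lt_or_eq.1 hu with hu | rfl
      · rw [← h2 u hu]
        simp [NExp.eval, hv, hu.ne]
      · simpa [NExp.eval, hv] using hb.1 h
    · simpa using hv
    · intro u hu
      rcases Nat.lt_succ_iff_lt_or_eq.1 hu with hu | rfl
      · rw [← h2 u hu]
        simp [NExp.eval, hv, hu.ne]
      · have := fun e => h (hb.2 e)
        simpa [NExp.eval, hv] using this
  · exact ⟨Frame.refl _ _ _, by simp⟩
  · exact fun m' h => h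
  case le => simp only [NExp.cost]; omega

/-- Keep the selected set if it is balanced and not worse than the best set so far. -/
def tryProg : Prog :=
  .seq countProg (.branch
    (.and (.natLe (.add (.var 10) (.var 10)) .size) (.natLe .size (.add (.var 10) (.var 10))))
    (.seq cutProg (.branch (.realLe (.var 3) (.var 4))
      (.seq (.setReal 4 (.lit 0) (.var 3)) copyProg) .skip)) .skip)

/-- The memory holds a balanced bipartition and its value. -/
def Memory.Solved (I : Input) (m : Memory) : Prop :=
  2 * #{u ∈ range I.size | m.nat 0 u = 1} = I.size ∧ m.real 4 0 = I.cut fun u => m.nat 0 u = 1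

/-- The alternative `m.real 4 0 = I.total` describes the state before any balanced set has been
found. As no cut exceeds the total, the first balanced candidate is always accepted, ties included.
-/
theorem ends_tryProg (I : Input) (m : Memory) (hm : m.Solved I ∨ m.real 4 0 = I.total) :
    Ends I tryProg m (I.size * (I.size * 70 + 150) + 250) fun m' =>
      Frame [0, 1, 2, 10] [3, 4] m m' ∧
      (m.Solved I → m'.Solved I) ∧ m'.real 4 0 ≤ m.real 4 0 ∧
      (m'.Solved I ∨ m'.real 4 0 = I.total) ∧
      (2 * #{u ∈ range I.size | m.Selects u} = I.size →
        m'.Solved I ∧ m'.real 4 0 ≤ I.cut m.Selects) := by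
  refine Ends.le (Ends.seq (T' := I.size * (I.size * 70 + 100) + 150)
    ((ends_countProg I m).mono le_rfl ?_)) ?le
  · rintro m₁ ⟨h1, h2⟩
    have f1 : Frame [0, 1, 2, 10] [3, 4] m m₁ := (Frame.refl _ _ _).trans h1 (by simp) (by simp)
    have sel1 : ∀ u, m₁.Selects u ↔ m.Selects u := fun u => by
      simp only [Memory.Selects, h1.1 7 (by simp), h1.1 8 (by simp), h1.1 3 (by simp)]
    have hb : (Test.and (.natLe (.add (.var 10) (.var 10)) .size)
        (.natLe .size (.add (.var 10) (.var 10)))).Holds I m₁ ↔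
        2 * #{u ∈ range I.size | m.Selects u} = I.size := by
      simp only [Test.Holds, NExp.eval, h2]
      omega
    have s1 : m.Solved I → m₁.Solved I := by
      simp only [Memory.Solved, h1.1 0 (by simp), h1.2 4 (by simp)]
      exact id
    refine Ends.le (Ends.branch (fun h => Ends.seq (T' := I.size * 50 + 60)
      ((ends_cutProg I m₁).mono le_rfl ?_)) fun h => Ends.skip ⟨f1, s1, ?_, ?_, ?_⟩) ?le'
    · rintro m₂ ⟨g1, g2⟩
      have f2 : Frame [0, 1, 2, 10] [3, 4] m m₂ := f1.trans g1 (by simp) (by simp)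
      have sel2 : ∀ u, m₂.Selects u ↔ m.Selects u := fun u => by
        rw [← sel1]
        simp only [Memory.Selects, g1.1 7 (by simp), g1.1 8 (by simp), g1.1 3 (by simp)]
      have c2 : m₂.real 3 0 = I.cut m.Selects := g2.trans (I.cut_congr fun u _ => sel1 u)
      have b2 : m₂.real 4 0 = m.real 4 0 := by rw [g1.2 4 (by simp), h1.2 4 (by simp)]
      have o2 : ∀ u, m₂.nat 0 u = m.nat 0 u := fun u => by rw [g1.1 0 (by simp), h1.1 0 (by simp)]
      refine Ends.le (Ends.branch (fun hle => Ends.seq (Ends.setReal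
        ((ends_copyProg I _).mono le_rfl ?_))) fun hle => Ends.skip ?_) ?le''
      · rintro m₃ ⟨k1, k2⟩
        have v3 : m₃.real 4 0 = I.cut m.Selects := by
          rw [k1.2 4 (by simp)]
          simp [RExp.eval, NExp.eval, c2]
        have o3 : ∀ u < I.size, m₃.nat 0 u = 1 ↔ m.Selects u := fun u hu =>
          (k2 u hu).trans (sel2 u)
        have sol : m₃.Solved I := by
          refine ⟨?_, v3.trans (I.cut_congr fun u hu => (o3 u hu).symm)⟩
          rw [filter_congr fun u hu => o3 u (mem_range.1 hu)]
          exact hb.1 h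
        simp only [Test.Holds, RExp.eval, NExp.eval, c2, b2] at hle
        exact ⟨(f2.setReal (by simp) _ _).trans k1 (by simp) (by simp), fun _ => sol,
          v3.trans_le hle, .inl sol, fun _ => ⟨sol, v3.le⟩⟩
      · simp only [Test.Holds, RExp.eval, NExp.eval, c2, b2, not_le] at hle
        have s2 : m.Solved I → m₂.Solved I := by
          simp only [Memory.Solved, o2, b2]
          exact id
        have sm : m.Solved I := hm.resolve_right fun e =>
          absurd (I.cut_le_total m.Selects) (by rw [← e]; exact not_le.2 hle)
        exact ⟨f2, s2, b2.le, .inl (s2 sm), fun _ => ⟨s2 sm, b2.trans_le hle.le⟩⟩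
      case le'' => simp only [Test.cost, NExp.cost, RExp.cost]; omega
    · exact (h1.2 4 (by simp) 0).le
    · exact hm.imp s1 fun e => (h1.2 4 (by simp) 0).trans e
    · exact fun e => absurd (hb.2 e) h
    case le' =>
      simp only [Test.cost, NExp.cost]
      have : I.size * (I.size * 70 + 100) = I.size * (I.size * 70 + 50) + I.size * 50 := by ring
      omega
  case le =>
    have : I.size * (I.size * 70 + 150) = I.size * (I.size * 70 + 100) + I.size * 50 := by ring
    omega

/-- Increment the number with base `size + 1` whose digits are stored in integer array `8`. -/
def incrProg : Prog :=
  .seq (.setNat 9 (.lit 0) (.lit 1)) (forLoop 1 (.var 5) (.branch (.natLe (.lit 1) (.var 9))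
    (.branch (.natLe .size (.get 8 (.var 1))) (.setNat 8 (.var 1) (.lit 0))
      (.seq (.setNat 8 (.var 1) (.add (.get 8 (.var 1)) (.lit 1))) (.setNat 9 (.lit 0) (.lit 0))))
    .skip))

/-- In the passage from N to N+1 in base b, a carry enters digit i exactly if b^i divides N+1. This
and the next two lemmas treat a digit without carry, the propagation of the carry, and the new value
of a digit that receives one. -/
theorem succ_div_pow_of_not_dvd {b i N : ℕ} (h : ¬ b ^ i ∣ N + 1) :
    (N + 1) / b ^ i = N / b ^ i := by
  rw [Nat.succ_div, if_neg h, add_zero]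

theorem pow_succ_dvd_succ_iff {b i N : ℕ} (hb : 0 < b) :
    b ^ (i + 1) ∣ N + 1 ↔ b ^ i ∣ N + 1 ∧ N / b ^ i % b = b - 1 := by
  have hbi : 0 < b ^ i := Nat.pow_pos hb
  have key : b ^ i ∣ N + 1 → (b ^ (i + 1) ∣ N + 1 ↔ N / b ^ i % b = b - 1) := by
    intro h
    have hs : (N + 1) / b ^ i = N / b ^ i + 1 := by rw [Nat.succ_div, if_pos h]
    obtain ⟨c, hc⟩ := h
    rw [hc, Nat.mul_div_cancel_left _ hbi] at hs
    rw [hc, pow_succ, Nat.mul_dvd_mul_iff_left hbi, hs]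
    have := Nat.mod_lt (N / b ^ i) hb
    constructor
    · intro hd
      have h1 := (Nat.dvd_iff_mod_eq_zero ..).1 hd
      by_contra hne
      rw [Nat.add_mod, Nat.mod_eq_of_lt (show 1 < b by omega),
        Nat.mod_eq_of_lt (show N / b ^ i % b + 1 < b by omega)] at h1
      omega
    · intro hd
      refine ⟨N / b ^ i / b + 1, ?_⟩
      have := Nat.div_add_mod (N / b ^ i) b
      rw [Nat.mul_add]
      omega
  exact ⟨fun h => have h' := (pow_dvd_pow b (Nat.le_succ i)).trans h; ⟨h', (key h').1 h⟩,
    fun h => (key h.1).2 h.2⟩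

theorem succ_div_pow_mod_of_dvd {b i N : ℕ} (hb : 0 < b) (h : b ^ i ∣ N + 1) :
    (N + 1) / b ^ i % b = if N / b ^ i % b = b - 1 then 0 else N / b ^ i % b + 1 := by
  have := Nat.mod_lt (N / b ^ i) hb
  rw [Nat.succ_div, if_pos h]
  split_ifs with hd
  · have h1 := (pow_succ_dvd_succ_iff hb).2 ⟨h, hd⟩
    rw [pow_succ] at h1
    have h2 := Nat.div_mul_cancel h
    have h3 : b ^ i * b ∣ b ^ i * ((N + 1) / b ^ i) := by rwa [mul_comm _ (_ / _), h2]
    rw [Nat.mul_dvd_mul_iff_left (Nat.pow_pos hb), Nat.succ_div, if_pos h] at h3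
    exact (Nat.dvd_iff_mod_eq_zero ..).1 h3
  · rw [Nat.add_mod, Nat.mod_eq_of_lt (show 1 < b by omega), Nat.mod_eq_of_lt (by omega)]

/-- The carry flag left at the end reports overflow of the M-digit counter; for N < (k+1)^M this
means N+1 = (k+1)^M, which ends the search. -/
theorem ends_incrProg (I : Input) (m : Memory) {M N : ℕ} (hM : m.nat 5 0 = M)
    (h8 : ∀ i < M, m.nat 8 i = N / (I.size + 1) ^ i % (I.size + 1)) :
    Ends I incrProg m (M * 60 + 50) fun m' => Frame [1, 8, 9] [] m m' ∧
      (∀ i < M, m'.nat 8 i = (N + 1) / (I.size + 1) ^ i % (I.size + 1)) ∧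
      m'.nat 9 0 = if (I.size + 1) ^ M ∣ N + 1 then 1 else 0 := by
  have hb0 : 0 < I.size + 1 := Nat.succ_pos _
  refine Ends.le (Ends.seq (Ends.setNat (Ends.forLoop (N := M) (T := 40)
    (fun i m' => Frame [1, 8, 9] [] m m' ∧
      (∀ j < i, m'.nat 8 j = (N + 1) / (I.size + 1) ^ j % (I.size + 1)) ∧
      (∀ j, i ≤ j → m'.nat 8 j = m.nat 8 j) ∧
      m'.nat 9 0 = if (I.size + 1) ^ i ∣ N + 1 then 1 else 0) ?_ ?_ ?_ ?_ ?_))) ?le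
  · rintro i m' ⟨h, -⟩
    exact (h.1 5 (by simp) 0).trans hM
  · rintro i m' a ⟨h1, h2, h3, h4⟩
    refine ⟨h1.setNat (by simp) _ _, ?_, ?_, ?_⟩
    · simpa using h2
    · simpa using h3
    · simpa using h4
  · rintro i hi m' ⟨h1, h2, h3, h4⟩ hv
    have hdig : m'.nat 8 i = N / (I.size + 1) ^ i % (I.size + 1) := (h3 i le_rfl).trans (h8 i hi)
    have hlt : N / (I.size + 1) ^ i % (I.size + 1) < I.size + 1 := Nat.mod_lt _ hb0
    have carry : (Test.natLe (.lit 1) (.var 9)).Holds I m' ↔ (I.size + 1) ^ i ∣ N + 1 := by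
      simp only [Test.Holds, NExp.eval, h4]
      split_ifs with e <;> simp [e]
    have digit : (Test.natLe .size (.get 8 (.var 1))).Holds I m' ↔
        I.size ≤ N / (I.size + 1) ^ i % (I.size + 1) := by
      simp only [Test.Holds, NExp.eval, hv, hdig]
    have full : (Test.natLe (.lit 1) (.var 9)).Holds I m' →
        (Test.natLe .size (.get 8 (.var 1))).Holds I m' →
        (I.size + 1) ^ i ∣ N + 1 ∧ N / (I.size + 1) ^ i % (I.size + 1) = I.size :=
      fun h h' => ⟨carry.1 h, le_antisymm (Nat.lt_succ_iff.1 hlt) (digit.1 h')⟩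
    have free : (Test.natLe (.lit 1) (.var 9)).Holds I m' →
        ¬ (Test.natLe .size (.get 8 (.var 1))).Holds I m' →
        (I.size + 1) ^ i ∣ N + 1 ∧ N / (I.size + 1) ^ i % (I.size + 1) ≠ I.size :=
      fun h h' => ⟨carry.1 h, fun e => h' (digit.2 e.ge)⟩
    refine Ends.le (Ends.branch (fun h => Ends.branch (fun h' => Ends.setNat
      ⟨?_, h1.setNat (by simp) _ _, ?_, ?_, ?_⟩) fun h' => Ends.seq (Ends.setNat (Ends.setNat
      ⟨?_, (h1.setNat (by simp) _ _).setNat (by simp) _ _, ?_, ?_, ?_⟩)))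
      fun h => Ends.skip ⟨hv, h1, ?_, ?_, ?_⟩) (by simp [Test.cost, NExp.cost])
    · simpa using hv
    · obtain ⟨hd, hz⟩ := full h h'
      intro j hj
      rcases Nat.lt_succ_iff_lt_or_eq.1 hj with hj | rfl
      · rw [← h2 j hj]; simp [NExp.eval, hv, hj.ne]
      · rw [succ_div_pow_mod_of_dvd hb0 hd, if_pos (by omega)]
        simp [NExp.eval, hv]
    · intro j hj
      rw [← h3 j (by omega)]
      simp [NExp.eval, hv, show j ≠ i by omega]
    · obtain ⟨hd, hz⟩ := full h h'
      rw [if_pos ((pow_succ_dvd_succ_iff hb0).2 ⟨hd, by omega⟩)]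
      simp [h4, hd]
    · simpa using hv
    · obtain ⟨hd, hz⟩ := free h h'
      intro j hj
      rcases Nat.lt_succ_iff_lt_or_eq.1 hj with hj | rfl
      · rw [← h2 j hj]; simp [NExp.eval, hv, hj.ne]
      · rw [succ_div_pow_mod_of_dvd hb0 hd, if_neg (by omega)]
        simp [NExp.eval, hv, hdig]
    · intro j hj
      rw [← h3 j (by omega)]
      simp [NExp.eval, hv, show j ≠ i by omega]
    · obtain ⟨hd, hz⟩ := free h h'
      rw [if_neg (fun e => hz ((pow_succ_dvd_succ_iff hb0).1 e).2)]
      simp [NExp.eval]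
    · intro j hj
      rcases Nat.lt_succ_iff_lt_or_eq.1 hj with hj | rfl
      · exact h2 j hj
      · rw [succ_div_pow_of_not_dvd fun e => h (carry.2 e), hdig]
    · exact fun j hj => h3 j (by omega)
    · have hd : ¬ (I.size + 1) ^ i ∣ N + 1 := fun e => h (carry.2 e)
      rw [h4, if_neg hd, if_neg (fun e => hd ((pow_dvd_pow _ (Nat.le_succ i)).trans e))]
  · refine ⟨(Frame.refl _ _ _).setNat (by simp) _ _, by simp, by simp, by simp [NExp.eval]⟩
  · exact fun m' h => ⟨h.1, h.2.1, h.2.2.2⟩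
  case le => simp only [NExp.cost]; omega

/-- The digits of `N` select the point `u`. -/
abbrev DigitSelects (b N : ℕ) (cl rk : ℕ → ℕ) (u : ℕ) : Prop := rk u < N / b ^ cl u % b

/-- Try the bipartitions of all vectors of digits. -/
def searchProg : Prog :=
  .seq (.setReal 4 (.lit 0) (.var 0)) (.loop (.natLe (.var 9) (.lit 0)) (.seq tryProg incrProg))

/-- Before round N the digits spell N in base k+1, so all vectors with entries from 0 to k occur. By
`hlt`, selection reads only the first `M` digits. -/
theorem ends_searchProg (I : Input) (m : Memory) {M : ℕ} {cl rk : ℕ → ℕ}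
    (hS : m.real 0 0 = I.total) (hM : m.nat 5 0 = M) (hcl : ∀ u, m.nat 3 u = cl u)
    (hrk : ∀ u, m.nat 7 u = rk u) (hlt : ∀ u < I.size, cl u < M) (h8 : ∀ u, m.nat 8 u = 0)
    (h9 : m.nat 9 0 = 0) :
    Ends I searchProg m
      ((I.size + 1) ^ M * (I.size * (I.size * 70 + 150) + M * 60 + 320) + 20) fun m' =>
      ∀ N < (I.size + 1) ^ M,
        2 * #{u ∈ range I.size | DigitSelects (I.size + 1) N cl rk u} = I.size →
        m'.Solved I ∧ m'.real 4 0 ≤ I.cut (DigitSelects (I.size + 1) N cl rk) := by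
  refine Ends.le (Ends.seq (Ends.setReal (Ends.loop (i := 0) (N := (I.size + 1) ^ M)
    (T := I.size * (I.size * 70 + 150) + M * 60 + 310) (fun N m' =>
      Frame [0, 1, 2, 8, 9, 10] [3, 4] m m' ∧
      (∀ i < M, m'.nat 8 i = N / (I.size + 1) ^ i % (I.size + 1)) ∧
      N ≤ (I.size + 1) ^ M ∧ (m'.nat 9 0 = 0 ↔ N < (I.size + 1) ^ M) ∧
      (m'.Solved I ∨ m'.real 4 0 = I.total) ∧
      ∀ N' < N, 2 * #{u ∈ range I.size | DigitSelects (I.size + 1) N' cl rk u} = I.size →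
        m'.Solved I ∧ m'.real 4 0 ≤ I.cut (DigitSelects (I.size + 1) N' cl rk)) ?_ ?_ ?_))) ?le
  · rintro N m₁ ⟨f1, g1, g2, g3, g4, g5⟩ hb
    have hN : N < (I.size + 1) ^ M := g3.1 (by simpa [Test.Holds, NExp.eval] using hb)
    refine ⟨hN, Ends.le (Ends.seq ((ends_tryProg I m₁ g4).mono le_rfl fun m₂ h2 =>
      (ends_incrProg I m₂ (M := M) (N := N) ?_ ?_).mono le_rfl fun m₃ h3 => ?_)) ?_⟩
    · rw [h2.1.1 5 (by simp), f1.1 5 (by simp), hM]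
    · intro i hi
      rw [h2.1.1 8 (by simp), g1 i hi]
    · obtain ⟨f2, k1, k2, k3, k4⟩ := h2
      obtain ⟨f3, l1, l2⟩ := h3
      have so : m₂.Solved I → m₃.Solved I := by
        simp only [Memory.Solved, f3.1 0 (by simp), f3.2 4 (by simp)]
        exact id
      have b3 : m₃.real 4 0 = m₂.real 4 0 := f3.2 4 (by simp) 0
      have sel : ∀ u < I.size, m₁.Selects u ↔ DigitSelects (I.size + 1) N cl rk u := by
        intro u hu
        simp only [Memory.Selects, DigitSelects, f1.1 7 (by simp), f1.1 3 (by simp), hrk, hcl]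
        rw [g1 _ (hlt u hu)]
      refine ⟨(f1.trans f2 (by simp) (by simp)).trans f3 (by simp) (by simp), l1, hN, ?_,
        k3.imp so b3.trans, ?_⟩
      · rw [l2]
        split_ifs with hd
        · have := Nat.le_of_dvd (Nat.succ_pos _) hd
          simp; omega
        · have : N + 1 ≠ (I.size + 1) ^ M := fun e => hd (dvd_of_eq e.symm)
          simp; omega
      · intro N' hN' hc
        rcases Nat.lt_succ_iff_lt_or_eq.1 hN' with h | rfl
        · obtain ⟨q1, q2⟩ := g5 N' h hc
          exact ⟨so (k1 q1), b3.trans_le (k2.trans q2)⟩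
        · rw [filter_congr fun u hu => (sel u (mem_range.1 hu)).symm] at hc
          obtain ⟨q1, q2⟩ := k4 hc
          exact ⟨so q1, b3.trans_le (q2.trans_eq (I.cut_congr sel))⟩
    · omega
  · refine ⟨(Frame.refl _ _ _).setReal (by simp) _ _, ?_, Nat.zero_le _, ?_, ?_, ?_⟩
    · intro i _
      simp [h8]
    · simp [h9]
    · right
      simpa [RExp.eval, NExp.eval] using hS
    · intro N' h; omega
  · rintro N m' ⟨f1, g1, g2, g3, g4, g5⟩ hb
    have : ¬ N < (I.size + 1) ^ M := fun e => hb (by simp [Test.Holds, NExp.eval, g3.2 e])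
    obtain rfl : N = (I.size + 1) ^ M := by omega
    exact g5
  case le =>
    simp only [Test.cost, NExp.cost, RExp.cost, Nat.sub_zero]
    have : (I.size + 1) ^ M * (1 + 1 + 1 + 1 + (I.size * (I.size * 70 + 150) + M * 60 + 310) + 1) ≤
        (I.size + 1) ^ M * (I.size * (I.size * 70 + 150) + M * 60 + 320) :=
      Nat.mul_le_mul_left _ (by omega)
    omega

/-! ### The whole program -/

/-- Compute the resolution of the clustering. -/
def resolutionProg : Prog :=
  .setReal 2 (.lit 0) (.div (.mul (.mul (.ofNat (.lit 100))
    (.pow (.add (.ofNat (.lit 1)) (.mul (.mul (.ofNat (.lit 45)) (.pow (.ofNat (.lit 2))))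
      (.div (.add (.ofNat (.lit 1)) .eps) .eps)))))
    (.pow (.ofNat (.lit 2)))) .eps)

/-- The approximation scheme. -/
def bisectionProg : Prog :=
  .seq resolutionProg (.seq weightProg (.seq clusterProg searchProg))

/-- The clustering is known only during the run, so `hQ` asks for the time bound and the conclusion
for every possible clustering. -/
theorem ends_bisectionProg (I : Input) (hε : 0 < I.eps)
    {T : ℕ} (hrefl : ∀ i < I.size, I.Close (resolution I.q I.eps) i i)
    {Q : Memory → Prop}
    (hQ : ∀ M cl cen sz rk, Clustering (I.Near (resolution I.q I.eps))
      (I.Close (resolution I.q I.eps)) I.size M cl cen sz rk →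
      (I.size + 1) ^ M * (I.size * (I.size * 70 + 150) + M * 60 + 320) + 20 ≤ T ∧
      ∀ m : Memory, (∀ N < (I.size + 1) ^ M,
        2 * #{u ∈ range I.size | DigitSelects (I.size + 1) N cl rk u} = I.size →
        m.Solved I ∧ m.real 4 0 ≤ I.cut (DigitSelects (I.size + 1) N cl rk)) → Q m) :
    Ends I bisectionProg .init (I.size * (I.size * 70 + 260) + 120 + T) Q := by
  refine Ends.le (Ends.seq (Ends.setReal (Ends.seq (T' :=
    I.size * (I.size * 40 + 200) + 50 + T)
    ((ends_weightProg I _ ?_ ?_).mono le_rfl fun m₁ h1 => Ends.seq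
    ((ends_clusterProg I (X := resolution I.q I.eps) m₁ ?_ h1.2.2 h1.2.1 ?_ hrefl).mono le_rfl
      fun m₂ h2 => ((ends_searchProg I m₂ ?_ rfl (fun _ => rfl) (fun _ => rfl) h2.2.lt ?_ ?_).mono
        (hQ _ _ _ _ _ h2.2).1 (hQ _ _ _ _ _ h2.2).2)))))) ?le
  · simp [Memory.init]
  · simp [Memory.init]
  · rw [h1.1.2 2 (by simp)]
    simp only [RExp.eval, NExp.eval, Memory.setReal_real, and_self, if_true, resolution, slack]
    norm_num
    -- The machine's power takes an absolute value, which is void here because the base is positive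
    -- for ε > 0.
    rw [abs_of_nonneg (a := 1 + _)]
    positivity
  · intro c
    rw [h1.1.1 6 (by simp)]
    simp [Memory.init]
  · rw [h2.1.2 0 (by simp), h1.2.2]
  · intro c
    rw [h2.1.1 8 (by simp), h1.1.1 8 (by simp)]
    simp [Memory.init]
  · rw [h2.1.1 9 (by simp), h1.1.1 9 (by simp)]
    simp [Memory.init]
  case le =>
    simp only [NExp.cost, RExp.cost]
    have : I.size * (I.size * 70 + 260) =
      I.size * (I.size * 40 + 200) + I.size * (I.size * 30 + 60) := by ring
    omega

/-- The ranks within a cluster run through 0, 1, 2, … without repetition, so the threshold `x`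
selects its first `x` members, or all of them if there are fewer. -/
theorem card_rank_lt (cl : ℕ → ℕ) (c x i : ℕ) :
    #{u ∈ range i | cl u = c ∧ #{v ∈ range u | cl v = c} < x} =
      min x #{u ∈ range i | cl u = c} := by
  induction i with
  | zero => simp
  | succ i ih =>
    rw [range_add_one, filter_insert, filter_insert]
    by_cases hc : cl i = c
    · rw [if_pos hc, card_insert_of_notMem (by simp)]
      by_cases hx : #{v ∈ range i | cl v = c} < x
      · rw [if_pos ⟨hc, hx⟩, card_insert_of_notMem (by simp), ih]
        omega
      · rw [if_neg (fun h => hx h.2), ih]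
        omega
    · rw [if_neg hc, if_neg (fun h => hc h.1), ih]

theorem exists_digits {b M : ℕ} (x : ℕ → ℕ) (hx : ∀ c < M, x c < b) :
    ∃ N < b ^ M, ∀ c < M, N / b ^ c % b = x c := by
  let f : Fin M → Fin b := fun c => ⟨x c, hx c c.2⟩
  refine ⟨finFunctionFinEquiv f, (finFunctionFinEquiv f).2, fun c hc => ?_⟩
  have := congrArg Fin.val (congrFun (finFunctionFinEquiv.symm_apply_apply f) ⟨c, hc⟩)
  simpa [finFunctionFinEquiv, f] using this

/-! ### The data of the program read in the metric space -/

section OfMetric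

variable {T : Type*} {k : ℕ} (e : Fin k ≃ T) (q ε : ℝ)

theorem sum_range_eq_sum [Fintype T] {M : Type*} [AddCommMonoid M] (g : ℕ → M) :
    ∑ i ∈ range k, g i = ∑ u : T, g (e.symm u) := by
  rw [sum_range, ← Equiv.sum_comp e.symm]

theorem card_filter_range_eq [Fintype T] (P : ℕ → Prop) [DecidablePred P] :
    #{i ∈ range k | P i} = #{u : T | P (e.symm u)} := by
  simp only [card_filter]
  exact sum_range_eq_sum e _

variable [PseudoMetricSpace T]

theorem ofMetric_pairWeight (u v : T) :
    (Input.ofMetric e q ε).pairWeight (e.symm u) (e.symm v) = powDist q u v := by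
  simp [Input.pairWeight, Input.ofMetric, powDist, abs_of_nonneg dist_nonneg]

variable [Fintype T]

theorem ofMetric_weight (u : T) :
    (Input.ofMetric e q ε).weight (e.symm u) = pointWeight (powDist q) u :=
  (sum_range_eq_sum e _).trans (sum_congr rfl fun v _ => ofMetric_pairWeight e q ε u v)

theorem ofMetric_total :
    (Input.ofMetric e q ε).total = ∑ u : T, pointWeight (powDist q) u :=
  (sum_range_eq_sum e _).trans (sum_congr rfl fun u _ => ofMetric_weight e q ε u)

theorem ofMetric_cut [DecidableEq T] (P : ℕ → Prop) [DecidablePred P] :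
    (Input.ofMetric e q ε).cut P = cutCost q {u : T | P (e.symm u)} := by
  calc (Input.ofMetric e q ε).cut P
      = ∑ u : T, ∑ v : T, if P (e.symm u) ∧ ¬ P (e.symm v) then powDist q u v else 0 := by
        refine (sum_range_eq_sum e _).trans (sum_congr rfl fun u _ =>
          (sum_range_eq_sum e _).trans (sum_congr rfl fun v _ => ?_))
        rw [ofMetric_pairWeight]
    _ = _ := by
        unfold cutCost
        rw [compl_filter, sum_filter]
        refine sum_congr rfl fun u _ => ?_
        by_cases hu : P (e.symm u)
        · simp [hu, sum_filter, powDist]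
        · simp [hu]

theorem ofMetric_near (X : ℝ) (u : T) : (Input.ofMetric e q ε).Near X (e.symm u) ↔
    Fintype.card T * pointWeight (powDist q) u ≤ X * ∑ v : T, pointWeight (powDist q) v := by
  have : Fintype.card T = k := by simpa using (Fintype.card_congr e).symm
  rw [Input.Near, ofMetric_weight, ofMetric_total, this]
  rfl

theorem ofMetric_close (X : ℝ) (u v : T) :
    (Input.ofMetric e q ε).Close X (e.symm u) (e.symm v) ↔
    X * (Fintype.card T : ℝ) ^ 2 * powDist q u v ≤ ∑ v : T, pointWeight (powDist q) v := by
  have : Fintype.card T = k := by simpa using (Fintype.card_congr e).symm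
  rw [Input.Close, ofMetric_pairWeight, ofMetric_total, this, sq]
  rfl

variable {e q ε}

/-- In a doubling space, the number of clusters is bounded. -/
theorem Clustering.le_of_doublingDimLE {D X : ℝ} (hT : DoublingDimLE T D) (hD : 0 ≤ D) (hq : 1 ≤ q)
    (hX : 0 < X) {j : ℕ} (hj : 2 * 2 ^ q * X ^ 2 ≤ 2 ^ j) {M : ℕ} {cl cen sz rk : ℕ → ℕ}
    (h : Clustering ((Input.ofMetric e q ε).Near X) ((Input.ofMetric e q ε).Close X) k M cl cen sz
      rk) (hrefl : ∀ i < k, (Input.ofMetric e q ε).Close X i i) :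
    M ≤ ⌊((2 : ℝ) ^ D) ^ (j + 1)⌋₊ + 1 := by
  classical
  -- Centers of different clusters are not close, whereas every point is close to itself. Cluster 0
  -- has no center and accounts for the final `+ 1`.
  have hinj : Set.InjOn cen (Ico 1 M) := by
    have key : ∀ c ∈ Ico 1 M, ∀ c' ∈ Ico 1 M, c < c' → cen c ≠ cen c' := by
      intro c hc c' hc' hlt heq
      rw [mem_Ico] at hc hc'
      refine h.sep c c' hc.1 hlt hc'.2 ?_
      rw [heq]
      exact hrefl _ (h.cen_near c' hc'.1 hc'.2).1
    intro c hc c' hc' heq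
    by_contra hne
    rcases lt_or_gt_of_ne hne with hlt | hlt
    · exact key c hc c' hc' hlt heq
    · exact key c' hc' c hc hlt heq.symm
  set A : Finset T := {u : T | (e.symm u : ℕ) ∈ (Ico 1 M).image cen} with hA
  have hcard : M - 1 ≤ #A := by
    calc M - 1 = #((Ico 1 M).image cen) := by rw [card_image_of_injOn hinj, Nat.card_Ico]
      _ ≤ #(A.image fun u => (e.symm u : ℕ)) := by
          refine card_le_card fun i hi => ?_
          obtain ⟨c, hc, rfl⟩ := mem_image.1 hi
          have hc' := mem_Ico.1 hc
          refine mem_image.2 ⟨e ⟨cen c, (h.cen_near c hc'.1 hc'.2).1⟩, ?_, by simp⟩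
          rw [hA, mem_filter]
          exact ⟨mem_univ _, by simpa using hi⟩
      _ ≤ #A := card_image_le
  have hbound := hT.card_net_le hD hq hX hj (A := A) ?_ ?_
  · have := hcard.trans (Nat.le_floor hbound)
    omega
  · intro u hu
    obtain ⟨c, hc, hcu⟩ := mem_image.1 (mem_filter.1 hu).2
    have hc' := mem_Ico.1 hc
    rw [← ofMetric_near e q ε, ← hcu]
    exact (h.cen_near c hc'.1 hc'.2).2
  · intro u hu v hv hne
    obtain ⟨c, hc, hcu⟩ := mem_image.1 (mem_filter.1 hu).2
    obtain ⟨d, hd, hdv⟩ := mem_image.1 (mem_filter.1 hv).2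
    have hc' := mem_Ico.1 hc
    have hd' := mem_Ico.1 hd
    rcases lt_trichotomy c d with hlt | rfl | hlt
    · rw [powDist_comm, ← not_le, ← ofMetric_close e q ε, ← hcu, ← hdv]
      exact h.sep c d hc'.1 hlt hd'.2
    · exact absurd (e.symm.injective (Fin.ext (hcu.symm.trans hdv))) hne
    · rw [← not_le, ← ofMetric_close e q ε, ← hcu, ← hdv]
      exact h.sep d c hd'.1 hlt hc'.2

/-- Some vector of digits selects a bipartition that is nearly as good as a given one. -/
theorem Clustering.exists_selection [DecidableEq T] (hq : 1 ≤ q) (hε : 0 < ε) {M : ℕ}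
    {cl cen sz rk : ℕ → ℕ} (h : Clustering ((Input.ofMetric e q ε).Near (resolution q ε))
      ((Input.ofMetric e q ε).Close (resolution q ε)) k M cl cen sz rk) {n : ℕ} (hk : k = 2 * n)
    (hn : 0 < n) {L : Finset T} (hL : #L = n) :
    ∃ N < (k + 1) ^ M, #{u : T | DigitSelects (k + 1) N cl rk (e.symm u)} = n ∧
      cutCost q {u : T | DigitSelects (k + 1) N cl rk (e.symm u)} ≤ (1 + ε) * cutCost q L := by
  have hT : Fintype.card T = k := by simpa using (Fintype.card_congr e).symm
  set κ : T → ℕ := fun u => cl (e.symm u) with hκ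
  have hx : ∀ c, #{u ∈ L | κ u = c} ≤ #{u : T | κ u = c} := fun c =>
    card_le_card (filter_subset_filter _ (subset_univ L))
  -- The digit of each cluster is the number of its points in `L`, which is at most k and hence a
  -- digit in base k+1.
  obtain ⟨N, hN, hdig⟩ := exists_digits (b := k + 1) (M := M) (fun c => #{u ∈ L | κ u = c})
    fun c _ => Nat.lt_succ_of_le ((card_filter_le _ _).trans (by omega))
  set A : Finset T := {u : T | DigitSelects (k + 1) N cl rk (e.symm u)} with hA
  have hlt : ∀ u : T, κ u < M := fun u => h.lt _ (e.symm u).2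
  have hcount : ∀ c, #{u ∈ A | κ u = c} = #{u ∈ L | κ u = c} := by
    intro c
    by_cases hc : c < M
    · have h1 : {u ∈ A | κ u = c} = ({u : T | cl (e.symm u) = c ∧
          #{v ∈ range (e.symm u) | cl v = c} < #{u ∈ L | κ u = c}} : Finset T) := by
        rw [hA, filter_filter]
        refine filter_congr fun u _ => ?_
        rw [and_comm]
        refine and_congr_right fun hu => ?_
        have hu' : cl (e.symm u) = c := hu
        rw [DigitSelects, h.rk_eq _ (e.symm u).2, hu', hdig c hc]
      rw [h1, ← card_filter_range_eq e fun i => cl i = c ∧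
        #{v ∈ range i | cl v = c} < #{u ∈ L | κ u = c}, card_rank_lt,
        card_filter_range_eq e fun i => cl i = c]
      exact min_eq_left (hx c)
    · have : ∀ B : Finset T, #{u ∈ B | κ u = c} = 0 := fun B => by
        rw [card_eq_zero, filter_eq_empty_iff]
        exact fun u _ hu => hc (hu ▸ hlt u)
      rw [this, this]
  have hAn : #A = n := by
    rw [← hL, card_eq_sum_card_fiberwise (f := κ) (t := range M)
      fun u _ => by simpa using hlt u, card_eq_sum_card_fiberwise (s := L) (f := κ) (t := range M)
      fun u _ => by simpa using hlt u]
    exact sum_congr rfl fun c _ => hcount c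
  have hcompl : ∀ B : Finset T, #B = n → #Bᶜ = n := fun B hB => by
    rw [card_compl, hT, hB]; omega
  have hk0 : 0 < k := by omega
  refine ⟨N, hN, hAn, ?_⟩
  -- The default center is never relevant: a point outside cluster 0 lies in a cluster whose center
  -- has index below `k`.
  refine cutWeight_powDist_le hq hε (κ := κ)
    (ρ := fun c => if hc : cen c < k then e ⟨cen c, hc⟩ else e ⟨0, hk0⟩) ?_ ?_ hn hAn hL
    (hcompl A hAn) (hcompl L hL) hcount
  · intro u hu
    have hnear := not_not.1 (mt (h.near_iff _ (e.symm u).2).2 hu)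
    have hcen := (h.cen_near _ (Nat.pos_of_ne_zero hu) (hlt u)).1
    rw [dif_pos hcen, ← ofMetric_close e q ε]
    simpa using h.close_cen _ (e.symm u).2 hnear
  · intro u hu
    have hnear := (h.near_iff _ (e.symm u).2).1 hu
    rw [ofMetric_near] at hnear
    exact (not_le.1 hnear).le

end OfMetric

end RealRAM

/-- For every constant `q ≥ 1`, the `q`-th power min-bisection problem over doubling metric spaces
admits a PTAS: there is a program that, for every `ε > 0`, outputs on every `k`-point (finite) metric
space, with `k ≥ 4` even, a balanced bipartition of value at most `(1 + ε)` times the optimum, and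
that runs, for every fixed `ε` and every fixed bound `D` on the doubling dimension, in time polynomial
in `k`. -/
theorem theorem4 (q : ℝ) (hq : 1 ≤ q) :
    ∃ P : RealRAM.Prog, ∀ ε : ℝ, 0 < ε → ∀ D : ℝ, 0 ≤ D → ∃ p : Polynomial ℕ,
      ∀ (T : Type*) [PseudoMetricSpace T] [Fintype T] [DecidableEq T] (k : ℕ) (e : Fin k ≃ T),
        4 ≤ k → Even k → DoublingDimLE T D →
          ∃ (m : RealRAM.Memory) (t : ℕ),
            RealRAM.Exec (RealRAM.Input.ofMetric e q ε) P RealRAM.Memory.init m t ∧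
            t ≤ p.eval k ∧
            (m.output e).card = k / 2 ∧
            cutCost q (m.output e) ≤ (1 + ε) * minBisection q T := by
  refine ⟨RealRAM.bisectionProg, fun ε hε D hD => ?_⟩
  -- The number `j` depends on q and ε only, so the bound `B` on the number of clusters depends on
  -- q, ε and D but not on the space, and may be the exponent of the polynomial.
  obtain ⟨j, hj⟩ := pow_unbounded_of_one_lt (2 * 2 ^ q * resolution q ε ^ 2) one_lt_two
  set B := ⌊((2 : ℝ) ^ D) ^ (j + 1)⌋₊ + 1 with hB
  refine ⟨.X * (70 * .X + 260) + 120 +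
    ((.X + 1) ^ B * (.X * (70 * .X + 150) + .C (B * 60 + 320)) + 20), ?_⟩
  intro T _ _ _ k e hk hev hT
  obtain ⟨n, hn⟩ := hev
  have hkn : k = 2 * n := by omega
  have hcardT : Fintype.card T = k := by simpa using (Fintype.card_congr e).symm
  have hrefl : ∀ i < k,
      (RealRAM.Input.ofMetric e q ε).Close (resolution q ε) i i := by
    intro i hi
    have h0 : (RealRAM.Input.ofMetric e q ε).pairWeight i i = 0 := by
      simp [RealRAM.Input.pairWeight, RealRAM.Input.ofMetric, Real.zero_rpow (by linarith : q ≠ 0)]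
    rw [RealRAM.Input.Close, h0, mul_zero]
    exact RealRAM.Input.total_nonneg _
  -- The search beats the selection that imitates the cluster counts of this optimal `L`.
  obtain ⟨L, hL, hopt⟩ := Finset.exists_mem_eq_inf'
    (Finset.powersetCard_nonempty.2 (Nat.div_le_self (Fintype.card T) 2)) (cutCost q (T := T))
  have hLn : L.card = n := by
    rw [(Finset.mem_powersetCard.1 hL).2, hcardT]; omega
  obtain ⟨m, t, hex, ht, hcard, hcost⟩ := RealRAM.ends_bisectionProg
    (RealRAM.Input.ofMetric e q ε) hε hrefl
    (T := (k + 1) ^ B * (k * (k * 70 + 150) + B * 60 + 320) + 20)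
    (Q := fun m => (m.output e).card = k / 2 ∧
      cutCost q (m.output e) ≤ (1 + ε) * minBisection q T) (by
    intro M cl cen sz rk h
    have hM : M ≤ B := RealRAM.Clustering.le_of_doublingDimLE hT hD hq (resolution_pos hq hε) hj.le
      h hrefl
    refine ⟨?_, fun m hm => ?_⟩
    · exact Nat.add_le_add_right (Nat.mul_le_mul (Nat.pow_le_pow_right (Nat.succ_pos _) hM)
        (Nat.add_le_add_right (Nat.add_le_add_left (Nat.mul_le_mul_right _ hM) _) _)) _
    · obtain ⟨N, hN, hA, hcost⟩ := h.exists_selection hq hε hkn (by omega) hLn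
      have hbal := RealRAM.card_filter_range_eq e (RealRAM.DigitSelects (k + 1) N cl rk)
      have hm' : ∀ N < (k + 1) ^ M,
          2 * ((Finset.range k).filter (RealRAM.DigitSelects (k + 1) N cl rk)).card = k →
          m.Solved (RealRAM.Input.ofMetric e q ε) ∧ m.real 4 0 ≤
            (RealRAM.Input.ofMetric e q ε).cut (RealRAM.DigitSelects (k + 1) N cl rk) := hm
      obtain ⟨⟨s1, s2⟩, s3⟩ := hm' N hN (by rw [hbal, hA, hkn])
      rw [s2, RealRAM.ofMetric_cut] at s3
      change 2 * ((Finset.range k).filter fun i => m.nat 0 i = 1).card = k at s1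
      rw [RealRAM.card_filter_range_eq e fun i => m.nat 0 i = 1] at s1
      refine ⟨?_, ?_⟩
      · change (Finset.filter _ _).card = _
        omega
      · rw [RealRAM.ofMetric_cut] at s3
        exact s3.trans (hcost.trans_eq (by rw [minBisection, hopt])))
  refine ⟨m, t, hex, ht.trans (le_of_eq ?_), hcard, hcost⟩
  simp only [Polynomial.eval_add, Polynomial.eval_mul, Polynomial.eval_pow, Polynomial.eval_X,
    Polynomial.eval_C, Polynomial.eval_one, Polynomial.eval_ofNat]
  change k * (k * 70 + 260) + 120 + _ = _
  ring
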